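/- Let $G$ be a finite abelian group, written additively. Fix an isomorphism $G\cong\mathbb Z_{n_1}\oplus\cdots\oplus\mathbb Z_{n_r}$ and primitive $n_i$-th roots of unity $\zeta_{n_i}\in\mathbb C$, put $\chi_g(x)=\prod_{i=1}^r\zeta_{n_i}^{g_ix_i}$ for $g,x\in G$, and $\chi_g(S)=\sum_{s\in S}\chi_g(s)$ for $S\subseteq G$. For $S=-S\subseteq G\setminus\{0\}$ let $\mathrm{Cay}(G,S)$ be the graph on $G$ in which $g,h$ are adjacent if and only if $h-g\in S$. A connected graph is distance-regular if for any vertices $x,y$ at distance $i$ the numbers of neighbours of $y$ at distance $i-1$, $i$, $i+1$ from $x$ depend only on $i$. A graph of diameter $d$ is antipodal if "being at distance $0$ or $d$" is an equivalence relation on its vertices. Let $\Gamma$ be a distance-regular graph with vertex set $X$, diameter $d$, adjacency matrix $A$ and distance matrices $A_0,\dots,A_d$. Let $\sigma=(\sigma_0,\dots,\sigma_d)$ be an ordering of its distinct eigenvalues with $\sigma_0$ the largest one, let $E_0=\frac1{|X|}J,E_1,\dots,E_d$ be the primitive idempotents of the Bose--Mesner algebra $\mathrm{span}_{\mathbb C}\{A_0,\dots,A_d\}$,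 numbered so that $AE_i=\sigma_iE_i$, and let $q_{i,j}^k$ be the Krein parameters, defined by $E_i\circ E_j=\frac1{|X|}\sum_k q_{i,j}^kE_k$ ($\circ$ the entrywise product). The ordering $\sigma$ is called $Q$-polynomial if $q_{i,j}^k\neq0$ implies $k\le i+j$, and $q_{i,j}^{i+j}\ne0$ whenever $i+j\le d$; $\Gamma$ is called $Q$-polynomial if it has such an ordering. For a $Q$-polynomial distance-regular graph $\Gamma=\mathrm{Cay}(G,S)$ with $Q$-polynomial ordering $\sigma$, the dual graph is $\widehat\Gamma=\mathrm{Cay}(G,\widehat S)$ with $\widehat S=\{g\in G\mid\chi_g(S)=\sigma_1\}$. Proposition. Let $\Gamma=\mathrm{Cay}(G,S)$ be a non-antipodal bipartite distance-regular Cayley graph over $G$ of diameter $3$. Then $\Gamma$ is $Q$-polynomial, and for every $Q$-polynomial ordering of $\Gamma$ the set $\widehat S$ satisfies $\widehat S=-\widehat S\subseteq G\setminus\{0\}$ and the dual graph $\widehat\Gamma=\mathrm{Cay}(G,\widehat S)$ is an antipodal non-bipartite distance-regular Cayley graph over $G$ of diameter $3$. -/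

import Mathlib

/-! ### Distance-regular, antipodal graphs -/

/-- `Γ` is distance-regular: it is connected and, for vertices `x`, `y` at distance `i`, the number
of neighbours of `y` at distance `i - 1`, `i`, `i + 1` from `x` (the first being `0` for `i = 0`)
depends only on `i`. -/
def SimpleGraph.IsDistanceRegular {V : Type*} (Γ : SimpleGraph V) : Prop :=
  Γ.Connected ∧ ∃ c a b : ℕ → ℕ, ∀ x y : V,
    {z | Γ.dist x z + 1 = Γ.dist x y ∧ Γ.Adj y z}.ncard = c (Γ.dist x y) ∧
    {z | Γ.dist x z = Γ.dist x y ∧ Γ.Adj y z}.ncard = a (Γ.dist x y) ∧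
    {z | Γ.dist x z = Γ.dist x y + 1 ∧ Γ.Adj y z}.ncard = b (Γ.dist x y)

/-- `Γ`, of diameter `d`, is antipodal: being at distance `0` or `d` is an equivalence relation. -/
def SimpleGraph.IsAntipodal {V : Type*} (Γ : SimpleGraph V) : Prop :=
  Equivalence fun x y : V => Γ.dist x y = 0 ∨ Γ.dist x y = Γ.diam

/-! ### The Bose-Mesner algebra and `Q`-polynomial orderings -/

open Classical in
/-- The `i`-th distance matrix of `Γ`. -/
noncomputable def SimpleGraph.distMatrix {V : Type*} (Γ : SimpleGraph V) (i : ℕ) :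
    Matrix V V ℂ :=
  Matrix.of fun x y => if Γ.dist x y = i then 1 else 0

/-- The Bose-Mesner algebra (as a space of matrices), spanned by the distance matrices
`A₀, …, A_d`, where `d` is the diameter. -/
noncomputable def SimpleGraph.boseMesner {V : Type*} (Γ : SimpleGraph V) :
    Submodule ℂ (Matrix V V ℂ) :=
  Submodule.span ℂ (Set.range fun i : Fin (Γ.diam + 1) => Γ.distMatrix i)

open Classical in
/-- `E₀, …, E_d` are the primitive idempotents of the Bose-Mesner algebra of `Γ`, numbered so that
`E₀ = J / |V|` and `A Eᵢ = σᵢ Eᵢ` with `A` the adjacency matrix. -/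
structure SimpleGraph.IsPrimitiveIdempotents {V : Type*} [Fintype V] (Γ : SimpleGraph V) {d : ℕ}
    (σ : Fin (d + 1) → ℝ) (E : Fin (d + 1) → Matrix V V ℂ) : Prop where
  span_eq : Submodule.span ℂ (Set.range E) = Γ.boseMesner
  ne_zero : ∀ i, E i ≠ 0
  mul_eq : ∀ i j, E i * E j = if i = j then E i else 0
  sum_eq : ∑ i, E i = 1
  zero_eq : E 0 = (Fintype.card V : ℂ)⁻¹ • Matrix.of fun _ _ => 1
  adj_mul : ∀ i, Γ.adjMatrix ℂ * E i = (σ i : ℂ) • E i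

/-- `q i j k` are the Krein parameters with respect to the idempotents `E`:
`Eᵢ ∘ Eⱼ = |V|⁻¹ ∑ₖ q i j k Eₖ` for the entrywise product. -/
def IsKreinParameters {V : Type*} [Fintype V] {d : ℕ} (E : Fin (d + 1) → Matrix V V ℂ)
    (q : Fin (d + 1) → Fin (d + 1) → Fin (d + 1) → ℂ) : Prop :=
  ∀ i j, Matrix.hadamard (E i) (E j) = (Fintype.card V : ℂ)⁻¹ • ∑ k, q i j k • E k

open Classical in
/-- `σ₀, …, σ_d` is a `Q`-polynomial ordering of `Γ`: it lists the distinct eigenvalues of `Γ`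
without repetition, the largest one first, `d` is the diameter, and the Krein parameters
for the corresponding ordering `E₀, …, E_d` of the primitive idempotents satisfy
`q i j k ≠ 0 → k ≤ i + j`, and `q i j (i + j) ≠ 0` whenever `i + j ≤ d`. -/
structure SimpleGraph.IsQPolynomialOrdering {V : Type*} [Fintype V] (Γ : SimpleGraph V) {d : ℕ}
    (σ : Fin (d + 1) → ℝ) : Prop where
  diam_eq : Γ.diam = d
  injective : Function.Injective σ
  range_eq : Set.range σ = spectrum ℝ (Γ.adjMatrix ℝ)
  greatest : ∀ i, σ i ≤ σ 0
  krein : ∃ (E : Fin (d + 1) → Matrix V V ℂ)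
      (q : Fin (d + 1) → Fin (d + 1) → Fin (d + 1) → ℂ),
    Γ.IsPrimitiveIdempotents σ E ∧ IsKreinParameters E q ∧
    (∀ i j k : Fin (d + 1), q i j k ≠ 0 → (k : ℕ) ≤ (i : ℕ) + (j : ℕ)) ∧
    (∀ i j k : Fin (d + 1), (k : ℕ) = (i : ℕ) + (j : ℕ) → q i j k ≠ 0)

/-! ### Cayley graphs over finite abelian groups, characters and dual graphs -/

/-- `S` is the connection set of a Cayley graph: it omits the identity and is closed under
inverses. (The Cayley graph itself is `SimpleGraph.addCayley S`.) -/
def IsConnectionSet {G : Type*} [AddCommGroup G] (S : Set G) : Prop :=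
  0 ∉ S ∧ ∀ s ∈ S, -s ∈ S

/-- A way of writing `G` as a direct sum of cyclic groups `ℤ/n₁ ⊕ ⋯ ⊕ ℤ/n_r`, together with a
choice of a primitive `nᵢ`-th root of unity for each `i`. -/
structure CyclicDecomposition (G : Type*) [AddCommGroup G] where
  r : ℕ
  n : Fin r → ℕ
  pos : ∀ i, 0 < n i
  equiv : G ≃+ ((i : Fin r) → ZMod (n i))
  ζ : Fin r → ℂ
  primitive : ∀ i, IsPrimitiveRoot (ζ i) (n i)

namespace CyclicDecomposition

/-- The character `χ_g (x) = ∏ᵢ ζᵢ ^ (gᵢ xᵢ)`. -/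
noncomputable def char {G : Type*} [AddCommGroup G] (D : CyclicDecomposition G) (g x : G) : ℂ :=
  ∏ i, D.ζ i ^ ((D.equiv g i).val * (D.equiv x i).val)

open Classical in
/-- The character sum `χ_g (S) = ∑_{s ∈ S} χ_g (s)`. -/
noncomputable def charSum {G : Type*} [AddCommGroup G] [Fintype G] (D : CyclicDecomposition G)
    (g : G) (S : Set G) : ℂ :=
  ∑ s : G with s ∈ S, D.char g s

/-- The eigenvalue class `{g ∈ G | χ_g (S) = θ}`. -/
def eigenClass {G : Type*} [AddCommGroup G] [Fintype G] (D : CyclicDecomposition G)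
    (S : Set G) (θ : ℝ) : Set G :=
  {g | D.charSum g S = (θ : ℂ)}

/-- The dual graph of `Cay(G, S)` with respect to an ordering `σ₀, …, σ_d` of its eigenvalues, where
`d ≥ 1`: the Cayley graph over `G` whose connection set is the eigenvalue class of `σ₁`. -/
def dualGraph {G : Type*} [AddCommGroup G] [Fintype G] (D : CyclicDecomposition G)
    (S : Set G) {d : ℕ} (σ : Fin (d + 2) → ℝ) : SimpleGraph G :=
  SimpleGraph.addCayley (D.eigenClass S (σ 1))

end CyclicDecomposition

/-- Every finite abelian group has such a decomposition. -/
theorem nonempty_cyclicDecomposition (G : Type*) [AddCommGroup G] [Finite G] :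
    Nonempty (CyclicDecomposition G) := by
  obtain ⟨ι, hι, n, hn, ⟨f⟩⟩ := AddCommGroup.equiv_directSum_zmod_of_finite' G
  classical
  let c := Fintype.equivFin ι
  let f₁ : G ≃+ ((i : ι) → ZMod (n i)) := f.trans (DirectSum.addEquivProd fun i => ZMod (n i))
  let f₂ : ((i : ι) → ZMod (n i)) ≃+ ((i : Fin (Fintype.card ι)) → ZMod (n (c.symm i))) :=
    { Equiv.piCongrLeft' (fun i => ZMod (n i)) c with map_add' := fun _ _ => rfl }
  exact ⟨⟨Fintype.card ι, fun i => n (c.symm i), fun i => lt_trans Nat.zero_lt_one (hn _),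
    f₁.trans f₂, fun i => Complex.exp (2 * Real.pi * Complex.I / (n (c.symm i) : ℕ)),
    fun i => Complex.isPrimitiveRoot_exp _ (lt_trans Nat.zero_lt_one (hn _)).ne'⟩⟩

/-!
A bipartite distance-regular graph of diameter `3` is the incidence graph of a symmetric design.
Write `k` for its valency, `μ` for the number of common neighbours of two vertices at distance `2`,
`U` for the number of vertices, `J` for the all-ones matrix and `K` for the matrix with entries `±1`
recording whether two vertices are on the same side. Counting common neighbours gives
`A² = (k - μ) I + (μ / 2) (J + K)` (`adj_mul_adj`), so the eigenvalues are `±k` and `±θ` with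
`θ² = k - μ`, and the primitive idempotents are `J / U`, `K / U` and `(R ± X) / 2`, where
`R = I - (J + K) / U` and `X = θ⁻¹ (A - k (J - K) / U)`. Entrywise multiplication by `K` permutes
these idempotents, so all Krein parameters follow from the entrywise square of `(R + X) / 2`
(`isKreinParameters`), and the ordering `k, θ, -θ, -k` is `Q`-polynomial. Conversely, `-k` cannot be
the second eigenvalue of a `Q`-polynomial ordering, because its idempotent squares entrywise to a
multiple of `J / U`; so the second eigenvalue `τ` satisfies `τ² = k - μ`
(`sq_eq_of_isQPolynomialOrdering`).

For a Cayley graph the character sum `f g = χ_g (S)` is the eigenvalue of the eigenvector `χ_g`. It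
is `k` only at `0`, it is `-k` at exactly one element `g₀`, of order `2`, it is `±τ` elsewhere, and
`f (g + g₀) = -f g`. Hence the indicator function of `{g | f g = τ}` is a combination of the
constant function, `f`, and the indicator functions of `0` and `g₀`. As the Fourier transform of an
indicator function, `f` satisfies `f * f = U f` for convolution, so the convolution square of the
indicator function can be computed (`sum_indicator_mul_indicator`). It shows that in the dual graph
two vertices not in the same coset of `{0, g₀}` have
`(U / 2 - 2 ± (U / 2 - 2 k) / τ) / 2` common neighbours, the sign depending on adjacency. Both
numbers are positive because the original graph is not antipodal (`krein_pos`), and then the dual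
graph is a distance-regular double cover of a complete graph (`IsDoubleCover.isDistanceRegular`); it
has diameter `3`, its fibres are the antipodal classes, and it contains triangles.
-/

/-! ### Bipartite distance-regular graphs of diameter three -/

/-- `Γ` is the incidence graph of a symmetric design with block size `k` and pair multiplicity `μ`,
where `ε` is `1` on the points and `-1` on the blocks (or conversely): distinct vertices on the
same side have `μ` common neighbours. The distances, which are determined by this, are recorded
as part of the structure. -/
structure SimpleGraph.IsDesignGraph {V : Type*} (Γ : SimpleGraph V) (k μ : ℕ) (ε : V → ℤ) :
    Prop where
  sign_sq : ∀ x, ε x * ε x = 1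
  sign_adj : ∀ x y, Γ.Adj x y → ε y = -ε x
  ncard_nbrs : ∀ x, {z | Γ.Adj x z}.ncard = k
  ncard_common : ∀ x y, x ≠ y → ε x = ε y → {z | Γ.Adj x z ∧ Γ.Adj y z}.ncard = μ
  pos : 0 < μ
  lt : μ < k
  connected : Γ.Connected
  dist_two : ∀ x y, Γ.dist x y = 2 ↔ x ≠ y ∧ ε x = ε y
  dist_three : ∀ x y, Γ.dist x y = 3 ↔ ε x ≠ ε y ∧ ¬ Γ.Adj x y
  diam_eq : Γ.diam = 3

theorem Set.ncard_setOf_eq {α : Type*} [Fintype α] (p : α → Prop) [DecidablePred p] :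
    {x | p x}.ncard = (Finset.univ.filter p).card := by
  rw [Set.ncard_eq_toFinset_card', Set.toFinset_ofPred]

namespace SimpleGraph

variable {V : Type*} {Γ : SimpleGraph V}

theorem IsDistanceRegular.exists_isDesignGraph [Finite V] (hreg : Γ.IsDistanceRegular)
    (hdiam : Γ.diam = 3) (hbip : Γ.IsBipartite) :
    ∃ (k μ : ℕ) (ε : V → ℤ), Γ.IsDesignGraph k μ ε := by
  obtain ⟨hconn, c, a, b, h⟩ := hreg
  let C : Γ.Coloring Bool := hbip.toColoring (by simp)
  have hC : ∀ x y, Even (Γ.dist x y) ↔ C x = C y := by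
    intro x y
    obtain ⟨p, hp⟩ := hconn.exists_walk_length_eq_dist x y
    rw [← hp, C.even_length_iff_congr p]
    cases C x <;> cases C y <;> simp
  have hε : ∀ x y, (if C x then (1 : ℤ) else -1) = (if C y then (1 : ℤ) else -1) ↔ C x = C y := by
    intro x y
    cases C x <;> cases C y <;> simp
  have hne : Γ.ediam ≠ ⊤ := ediam_ne_top_of_diam_ne_zero (by omega)
  have hle : ∀ x y, Γ.dist x y ≤ 3 := fun x y => hdiam ▸ dist_le_diam hne
  have hnbr : ∀ x, {z | Γ.Adj x z}.ncard = b 0 := by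
    intro x
    have := (h x x).2.2
    simpa [dist_eq_one_iff_adj] using this
  have h2 : ∀ x y, Γ.dist x y = 2 → {z | Γ.Adj x z ∧ Γ.Adj y z}.ncard = c 2 := by
    intro x y hxy
    have := (h x y).1
    simpa [hxy, dist_eq_one_iff_adj] using this
  have hd2 : ∀ x y, Γ.dist x y = 2 ↔ x ≠ y ∧ C x = C y := by
    intro x y
    rw [← hC, ne_eq, ← hconn.dist_eq_zero_iff]
    have := hle x y
    generalize Γ.dist x y = m at *
    interval_cases m <;> decide
  have hd3 : ∀ x y, Γ.dist x y = 3 ↔ C x ≠ C y ∧ ¬ Γ.Adj x y := by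
    intro x y
    rw [ne_eq, ← hC, ← dist_eq_one_iff_adj]
    have := hle x y
    generalize Γ.dist x y = m at *
    interval_cases m <;> decide
  -- A geodesic `u, w₁, w₂, v` of length three shows `0 < μ < k`.
  obtain ⟨w₂, v, u, w₁, huw, hw₂v, hw₁, hw₂⟩ : ∃ w₂ v u w₁, Γ.dist u w₂ = 2 ∧
      Γ.dist u v = 3 ∧ (Γ.Adj u w₁ ∧ Γ.Adj w₂ w₁) ∧ Γ.Adj w₂ v := by
    have := hconn.nonempty
    obtain ⟨u, v, huv⟩ := Γ.exists_dist_eq_diam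
    obtain ⟨p, hp⟩ := hconn.exists_walk_length_eq_dist u v
    rw [huv, hdiam] at hp
    match p, hp with
    | .cons (v := w₁) h₁ (.cons (v := w₂) h₂ (.cons h₃ .nil)), _ =>
      refine ⟨w₂, v, u, w₁, le_antisymm (dist_le (.cons h₁ (.cons h₂ .nil))) ?_, huv.trans hdiam,
        ⟨h₁, h₂.symm⟩, h₃⟩
      have := hconn.dist_triangle (u := u) (v := w₂) (w := v)
      rw [dist_eq_one_iff_adj.2 h₃] at this
      omega
  refine ⟨b 0, c 2, fun x => if C x then 1 else -1, ?_, ?_, hnbr, ?_, ?_, ?_, hconn, ?_, ?_, hdiam⟩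
  · intro x; cases C x <;> simp
  · intro x y hxy
    have := C.valid hxy
    revert this
    cases C x <;> cases C y <;> simp
  · intro x y hxy hs
    exact h2 x y ((hd2 x y).2 ⟨hxy, (hε x y).1 hs⟩)
  · rw [← h2 u w₂ huw]
    exact (Set.ncard_pos (Set.toFinite _)).2 ⟨w₁, hw₁⟩
  · rw [← h2 u w₂ huw, ← hnbr w₂]
    refine Set.ncard_lt_ncard ⟨fun z hz => hz.2, fun hsub => ?_⟩ (Set.toFinite _)
    have := dist_eq_one_iff_adj.2 (hsub (show v ∈ {z | Γ.Adj w₂ z} from hw₂)).1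
    omega
  · intro x y; rw [hε, hd2]
  · intro x y; rw [ne_eq, hε, hd3]

namespace IsDesignGraph

/-- The matrix with entry `1` at pairs on the same side of the bipartition and `-1` elsewhere. -/
noncomputable def signMatrix (𝕜 : Type*) [Field 𝕜] (ε : V → ℤ) : Matrix V V 𝕜 :=
  Matrix.of fun x y => ((ε x * ε y : ℤ) : 𝕜)

/-- The all-ones matrix. -/
def onesMatrix (V 𝕜 : Type*) [Field 𝕜] : Matrix V V 𝕜 := Matrix.of fun _ _ => 1

variable {k μ : ℕ} {ε : V → ℤ} (h : Γ.IsDesignGraph k μ ε)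
include h

theorem sign_eq (x : V) : ε x = 1 ∨ ε x = -1 := by
  have := h.sign_sq x
  rcases mul_self_eq_one_iff.1 this with h | h <;> simp [h]

theorem two_le : 2 ≤ k := by have := h.pos; have := h.lt; omega

variable [Fintype V] (𝕜 : Type*) [Field 𝕜] [CharZero 𝕜]

open scoped Classical

omit [CharZero 𝕜] in
theorem sum_adj (x : V) : ∑ y, Γ.adjMatrix 𝕜 x y = k := by
  rw [← h.ncard_nbrs x, Set.ncard_eq_toFinset_card']
  simp [adjMatrix_apply]

theorem adj_mul_ones : Γ.adjMatrix 𝕜 * onesMatrix V 𝕜 = (k : 𝕜) • onesMatrix V 𝕜 := by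
  ext x y
  simpa [Matrix.mul_apply, onesMatrix] using h.sum_adj 𝕜 x

omit [CharZero 𝕜] in
theorem adj_mul_sign : Γ.adjMatrix 𝕜 * signMatrix 𝕜 ε = -((k : 𝕜) • signMatrix 𝕜 ε) := by
  ext x y
  simp only [Matrix.mul_apply, signMatrix, Matrix.of_apply, Matrix.neg_apply, Matrix.smul_apply,
    smul_eq_mul]
  rw [← h.sum_adj 𝕜 x, Finset.sum_mul, ← Finset.sum_neg_distrib]
  refine Finset.sum_congr rfl fun z _ => ?_
  by_cases hz : Γ.Adj x z
  · simp [adjMatrix_apply, hz, h.sign_adj x z hz]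
  · simp [adjMatrix_apply, hz]

omit h [CharZero 𝕜] [Fintype V] in
theorem transpose_ones : (onesMatrix V 𝕜).transpose = onesMatrix V 𝕜 := rfl

omit h [CharZero 𝕜] [Fintype V] in
theorem transpose_sign : (signMatrix 𝕜 ε).transpose = signMatrix 𝕜 ε := by
  ext x y; simp [signMatrix, mul_comm]

theorem ones_mul_adj : onesMatrix V 𝕜 * Γ.adjMatrix 𝕜 = (k : 𝕜) • onesMatrix V 𝕜 := by
  have := congrArg Matrix.transpose (h.adj_mul_ones 𝕜)
  simpa [Matrix.transpose_mul, transpose_ones] using this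

omit [CharZero 𝕜] in
theorem sign_mul_adj : signMatrix 𝕜 ε * Γ.adjMatrix 𝕜 = -((k : 𝕜) • signMatrix 𝕜 ε) := by
  have := congrArg Matrix.transpose (h.adj_mul_sign 𝕜)
  simpa [Matrix.transpose_mul, transpose_sign] using this

omit [Fintype V] in
theorem cast_k_ne_zero : (k : 𝕜) ≠ 0 := by
  have := h.two_le
  exact_mod_cast (by omega : k ≠ 0)

theorem ones_mul_sign : onesMatrix V 𝕜 * signMatrix 𝕜 ε = 0 := by
  have h1 := Matrix.mul_assoc (onesMatrix V 𝕜) (Γ.adjMatrix 𝕜) (signMatrix 𝕜 ε)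
  rw [h.ones_mul_adj, h.adj_mul_sign, Matrix.smul_mul, Matrix.mul_neg, Matrix.mul_smul,
    eq_neg_iff_add_eq_zero, ← add_smul] at h1
  have := h.cast_k_ne_zero 𝕜
  refine (smul_eq_zero.1 h1).resolve_left ?_
  rw [← two_mul]; simpa using this

theorem sign_mul_ones : signMatrix 𝕜 ε * onesMatrix V 𝕜 = 0 := by
  have := congrArg Matrix.transpose (h.ones_mul_sign 𝕜)
  simpa [Matrix.transpose_mul, transpose_sign, transpose_ones] using this

omit h [CharZero 𝕜] in
theorem ones_mul_ones :
    onesMatrix V 𝕜 * onesMatrix V 𝕜 = (Fintype.card V : 𝕜) • onesMatrix V 𝕜 := by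
  ext x y; simp [onesMatrix, Matrix.mul_apply]

omit [CharZero 𝕜] in
theorem sign_mul_sign :
    signMatrix 𝕜 ε * signMatrix 𝕜 ε = (Fintype.card V : 𝕜) • signMatrix 𝕜 ε := by
  ext x y
  have : ∀ z, ((ε x * ε z : ℤ) : 𝕜) * ((ε z * ε y : ℤ) : 𝕜) = ((ε x * ε y : ℤ) : 𝕜) := by
    intro z
    rw [← Int.cast_mul]
    congr 1
    linear_combination ε x * ε y * h.sign_sq z
  simp only [signMatrix, Matrix.mul_apply, Matrix.of_apply, this]
  simp

/-- Counting common neighbours: the square of the adjacency matrix. -/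
theorem adj_mul_adj : Γ.adjMatrix 𝕜 * Γ.adjMatrix 𝕜 =
    ((k : 𝕜) - μ) • 1 + ((μ : 𝕜) / 2) • (onesMatrix V 𝕜 + signMatrix 𝕜 ε) := by
  ext x y
  have hc : (Γ.adjMatrix 𝕜 * Γ.adjMatrix 𝕜) x y = ({z | Γ.Adj x z ∧ Γ.Adj y z}.ncard : 𝕜) := by
    rw [Set.ncard_setOf_eq, ← Finset.sum_boole, Matrix.mul_apply]
    refine Finset.sum_congr rfl fun z _ => ?_
    simp [adjMatrix_apply, Γ.adj_comm y, ite_and]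
    split_ifs <;> rfl
  rw [hc]
  by_cases hxy : x = y
  · subst hxy
    have hK : signMatrix 𝕜 ε x x = 1 := by
      simp only [signMatrix, Matrix.of_apply, h.sign_sq, Int.cast_one]
    simp [h.ncard_nbrs, onesMatrix, hK]
  by_cases hs : ε x = ε y
  · rw [h.ncard_common x y hxy hs]
    have hK : signMatrix 𝕜 ε x y = 1 := by
      simp only [signMatrix, Matrix.of_apply, hs, h.sign_sq, Int.cast_one]
    simp [hxy, onesMatrix, hK]
  · have hem : {z | Γ.Adj x z ∧ Γ.Adj y z} = ∅ := by
      ext z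
      simp only [Set.mem_ofPred_eq, Set.mem_empty_iff_false, iff_false, not_and]
      intro h1 h2
      have := h.sign_adj _ _ h1
      have := h.sign_adj _ _ h2
      omega
    have hs' : ε x * ε y = -1 := by
      rcases h.sign_eq x with h1 | h1 <;> rcases h.sign_eq y with h2 | h2 <;> simp_all
    have hK : signMatrix 𝕜 ε x y = -1 := by
      simp only [signMatrix, Matrix.of_apply, hs', Int.cast_neg, Int.cast_one]
    rw [hem]
    simp [hxy, onesMatrix, hK]

/-- The walks of length two from a vertex, counted by their endpoints. -/
theorem card_eq : (k : 𝕜) ^ 2 = k - μ + μ * Fintype.card V / 2 := by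
  have := h.connected.nonempty
  obtain ⟨x⟩ := this
  have h1 := Matrix.mul_assoc (Γ.adjMatrix 𝕜) (Γ.adjMatrix 𝕜) (onesMatrix V 𝕜)
  rw [h.adj_mul_adj, h.adj_mul_ones, Matrix.mul_smul, h.adj_mul_ones, add_mul, smul_mul_assoc,
    smul_mul_assoc, add_mul, h.sign_mul_ones, ones_mul_ones] at h1
  have := congrFun (congrFun h1 x) x
  simp [onesMatrix] at this
  linear_combination -this

/-- A non-antipodal graph has at least two vertices at distance three from each vertex. -/
theorem two_mul_add_four_le (hanti : ¬ Γ.IsAntipodal) : 2 * k + 4 ≤ Fintype.card V := by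
  have hcount : ∀ x, 2 * {y | Γ.dist x y = 3}.ncard + 2 * k = Fintype.card V := by
    intro x
    have hs : ∑ y, ε y = 0 := by
      have := congrFun (congrFun (h.ones_mul_sign ℚ) x) x
      simp only [onesMatrix, signMatrix, Matrix.mul_apply, Matrix.of_apply, one_mul,
        Matrix.zero_apply, ← Int.cast_sum, Int.cast_eq_zero, ← Finset.sum_mul] at this
      refine (mul_eq_zero.1 this).resolve_right fun h0 => ?_
      have := h.sign_sq x
      simp [h0] at this
    have h1 : ∀ y, (1 : ℤ) - ε x * ε y =
        2 * (if Γ.dist x y = 3 then 1 else 0) + 2 * (if Γ.Adj x y then 1 else 0) := by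
      intro y
      simp only [h.dist_three]
      by_cases ha : Γ.Adj x y
      · have := h.sign_sq x
        simp [ha, h.sign_adj _ _ ha, this]
      · rcases h.sign_eq x with h1 | h1 <;> rcases h.sign_eq y with h2 | h2 <;> simp [h1, h2, ha]
    have h2 := Finset.sum_congr rfl fun y (_ : y ∈ Finset.univ) => h1 y
    rw [Finset.sum_sub_distrib, ← Finset.mul_sum, hs, Finset.sum_add_distrib, ← Finset.mul_sum,
      ← Finset.mul_sum] at h2
    have h3 : ∑ y, (if Γ.dist x y = 3 then (1 : ℤ) else 0) = ({y | Γ.dist x y = 3}.ncard : ℤ) := by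
      rw [Set.ncard_setOf_eq, Finset.sum_boole]
    have h4 : ∑ y, (if Γ.Adj x y then (1 : ℤ) else 0) = (k : ℤ) := by
      rw [← h.ncard_nbrs x, Set.ncard_setOf_eq, Finset.sum_boole]
    rw [h3, h4] at h2
    simp at h2
    omega
  by_contra hlt
  apply hanti
  have huniq : ∀ x y z, Γ.dist x y = 3 → Γ.dist x z = 3 → y = z := by
    intro x y z hy hz
    have : {y | Γ.dist x y = 3}.ncard ≤ 1 := by have := hcount x; omega
    exact (Set.ncard_le_one (Set.toFinite _)).1 this _ hy _ hz
  unfold IsAntipodal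
  rw [h.diam_eq]
  refine ⟨fun x => by simp, fun {x y} hxy => by rwa [dist_comm], fun {x y z} hxy hyz => ?_⟩
  rcases hxy with hxy | hxy
  · rw [h.connected.dist_eq_zero_iff] at hxy; rwa [hxy]
  rcases hyz with hyz | hyz
  · rw [h.connected.dist_eq_zero_iff] at hyz; rw [← hyz]; exact Or.inr hxy
  · left
    rw [h.connected.dist_eq_zero_iff]
    exact huniq y x z (by rwa [dist_comm]) hyz

end IsDesignGraph
end SimpleGraph

/-! ### Primitive idempotents of the incidence graph of a symmetric design -/

namespace SimpleGraph.IsDesignGraph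

variable {V : Type*} {Γ : SimpleGraph V} {k μ : ℕ} {ε : V → ℤ}

open scoped Classical

/-- The eigenvalues `k, θ, -θ, -k`, in this order, where `θ² = k - μ`. -/
def eigenvalue {𝕜 : Type*} [Field 𝕜] (k : ℕ) (θ : 𝕜) : Fin 4 → 𝕜 := ![k, θ, -θ, -k]

section

variable [Fintype V] {𝕜 : Type*} [Field 𝕜]

/-- The part of the adjacency matrix acting on the orthogonal complement of the two
one-dimensional eigenspaces, scaled by `θ⁻¹` so that its square is a projection. -/
noncomputable def restAdj (Γ : SimpleGraph V) (k : ℕ) (ε : V → ℤ) (θ : 𝕜) : Matrix V V 𝕜 :=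
  θ⁻¹ • (Γ.adjMatrix 𝕜 - ((k : 𝕜) * (Fintype.card V : 𝕜)⁻¹) • (onesMatrix V 𝕜 - signMatrix 𝕜 ε))

/-- The projection onto the orthogonal complement of the two one-dimensional eigenspaces. -/
noncomputable def restOne (V : Type*) [Fintype V] (𝕜 : Type*) [Field 𝕜] (ε : V → ℤ) :
    Matrix V V 𝕜 :=
  1 - (Fintype.card V : 𝕜)⁻¹ • (onesMatrix V 𝕜 + signMatrix 𝕜 ε)

/-- The projections onto the eigenspaces for `k, θ, -θ, -k`, in this order. -/
noncomputable def idempotent (Γ : SimpleGraph V) (k : ℕ) (ε : V → ℤ) (θ : 𝕜) :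
    Fin 4 → Matrix V V 𝕜 :=
  ![(Fintype.card V : 𝕜)⁻¹ • onesMatrix V 𝕜,
    (2⁻¹ : 𝕜) • (restOne V 𝕜 ε + restAdj Γ k ε θ),
    (2⁻¹ : 𝕜) • (restOne V 𝕜 ε - restAdj Γ k ε θ),
    (Fintype.card V : 𝕜)⁻¹ • signMatrix 𝕜 ε]

variable [CharZero 𝕜] (h : Γ.IsDesignGraph k μ ε) {θ : 𝕜}
include h

omit [Fintype V] in
theorem theta_ne_zero (hθ : θ ^ 2 = k - μ) : θ ≠ 0 := by
  rintro rfl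
  have hlt := h.lt
  have : (k : 𝕜) = μ := by linear_combination -hθ
  have : k = μ := by exact_mod_cast this
  omega

variable (𝕜) in
theorem card_ne_zero : (Fintype.card V : 𝕜) ≠ 0 := by
  have := h.connected.nonempty
  exact_mod_cast Fintype.card_ne_zero

theorem rest_relations (hθ : θ ^ 2 = k - μ) :
    restOne V 𝕜 ε * restOne V 𝕜 ε = restOne V 𝕜 ε ∧
    restOne V 𝕜 ε * restAdj Γ k ε θ = restAdj Γ k ε θ ∧
    restAdj Γ k ε θ * restOne V 𝕜 ε = restAdj Γ k ε θ ∧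
    restAdj Γ k ε θ * restAdj Γ k ε θ = restOne V 𝕜 ε := by
  have hU := h.card_ne_zero 𝕜
  have hθ0 := h.theta_ne_zero hθ
  have hc := h.card_eq 𝕜
  unfold restOne restAdj
  refine ⟨?_, ?_, ?_, ?_⟩ <;>
  simp only [mul_add, add_mul, mul_sub, sub_mul, mul_one, one_mul, smul_mul_assoc, mul_smul_comm,
    h.ones_mul_sign, h.sign_mul_ones, h.sign_mul_sign, ones_mul_ones, h.adj_mul_ones,
    h.ones_mul_adj, h.adj_mul_sign, h.sign_mul_adj, h.adj_mul_adj]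
  · match_scalars <;> field_simp <;> ring
  · match_scalars <;> field_simp <;> ring
  · match_scalars <;> field_simp <;> ring
  · match_scalars <;> field_simp
    · linear_combination -hθ
    · linear_combination -2 * hc + 2 * hθ
    · linear_combination -2 * hc + 2 * hθ

theorem ones_mul_rest :
    onesMatrix V 𝕜 * restOne V 𝕜 ε = 0 ∧ restOne V 𝕜 ε * onesMatrix V 𝕜 = 0 ∧
    onesMatrix V 𝕜 * restAdj Γ k ε θ = 0 ∧ restAdj Γ k ε θ * onesMatrix V 𝕜 = 0 := by
  have hU := h.card_ne_zero 𝕜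
  unfold restOne restAdj
  refine ⟨?_, ?_, ?_, ?_⟩ <;>
  simp only [mul_add, add_mul, mul_sub, sub_mul, mul_one, one_mul, smul_mul_assoc, mul_smul_comm,
    h.ones_mul_sign, h.sign_mul_ones, ones_mul_ones, h.adj_mul_ones,
    h.ones_mul_adj] <;>
  match_scalars <;> field_simp <;> ring

theorem sign_mul_rest :
    signMatrix 𝕜 ε * restOne V 𝕜 ε = 0 ∧ restOne V 𝕜 ε * signMatrix 𝕜 ε = 0 ∧
    signMatrix 𝕜 ε * restAdj Γ k ε θ = 0 ∧ restAdj Γ k ε θ * signMatrix 𝕜 ε = 0 := by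
  have hU := h.card_ne_zero 𝕜
  unfold restOne restAdj
  refine ⟨?_, ?_, ?_, ?_⟩ <;>
  simp only [mul_add, add_mul, mul_sub, sub_mul, mul_one, one_mul, smul_mul_assoc, mul_smul_comm,
    h.ones_mul_sign, h.sign_mul_ones, h.sign_mul_sign,
    h.adj_mul_sign, h.sign_mul_adj] <;>
  match_scalars <;> field_simp <;> ring

theorem idempotent_mul (hθ : θ ^ 2 = k - μ) (i j : Fin 4) :
    idempotent Γ k ε θ i * idempotent Γ k ε θ j = if i = j then idempotent Γ k ε θ i else 0 := by
  have hU := h.card_ne_zero 𝕜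
  obtain ⟨r1, r2, r3, r4⟩ := h.rest_relations hθ
  obtain ⟨o1, o2, o3, o4⟩ := h.ones_mul_rest (θ := θ)
  obtain ⟨s1, s2, s3, s4⟩ := h.sign_mul_rest (θ := θ)
  fin_cases i <;> fin_cases j <;>
  simp [idempotent, mul_add, add_mul, mul_sub, sub_mul, r1, r2, r3, r4, o1, o2, o3, o4, s1, s2,
    s3, s4, ones_mul_ones, h.sign_mul_sign, h.ones_mul_sign, h.sign_mul_ones, hU] <;>
  module

omit h in
theorem sum_idempotent (Γ : SimpleGraph V) (k : ℕ) (ε : V → ℤ) (θ : 𝕜) :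
    ∑ i, idempotent Γ k ε θ i = 1 := by
  simp only [Fin.sum_univ_four, idempotent, Matrix.cons_val, restOne]
  module

/-- The spectral decomposition of the adjacency matrix. -/
theorem sum_eigenvalue_smul_idempotent (hθ : θ ^ 2 = k - μ) :
    ∑ i, eigenvalue k θ i • idempotent Γ k ε θ i = Γ.adjMatrix 𝕜 := by
  have hU := h.card_ne_zero 𝕜
  have hθ0 := h.theta_ne_zero hθ
  simp only [Fin.sum_univ_four, idempotent, eigenvalue, Matrix.cons_val, restOne, restAdj]
  match_scalars <;> field_simp <;> ring

theorem adj_mul_idempotent (hθ : θ ^ 2 = k - μ) (i : Fin 4) :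
    Γ.adjMatrix 𝕜 * idempotent Γ k ε θ i = eigenvalue k θ i • idempotent Γ k ε θ i := by
  rw [← h.sum_eigenvalue_smul_idempotent hθ, Finset.sum_mul]
  simp [h.idempotent_mul hθ]

/-- There are more than two vertices, so the eigenspaces for `θ` and `-θ` are nonzero. -/
theorem idempotent_ne_zero (hcard : 2 * k + 4 ≤ Fintype.card V) (i : Fin 4) :
    idempotent Γ k ε θ i ≠ 0 := by
  have hU := h.card_ne_zero 𝕜
  have := h.connected.nonempty
  obtain ⟨x⟩ := this
  have hK : signMatrix 𝕜 ε x x = 1 := by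
    simp only [signMatrix, Matrix.of_apply, h.sign_sq, Int.cast_one]
  have hR : (1 : 𝕜) - (Fintype.card V : 𝕜)⁻¹ * 2 ≠ 0 := by
    intro h0
    have h1 : (Fintype.card V : 𝕜) = 2 := by field_simp at h0; linear_combination h0
    have h2 : Fintype.card V = 2 := by exact_mod_cast h1
    omega
  intro h0
  have h1 := congrFun (congrFun h0 x) x
  fin_cases i <;>
    simp [idempotent, restOne, restAdj, onesMatrix, hK, hU] at h1
  all_goals exact hR (by rw [mul_two]; exact h1)

theorem spectrum_eq (hcard : 2 * k + 4 ≤ Fintype.card V) (hθ : θ ^ 2 = k - μ) :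
    Set.range (eigenvalue k θ) = spectrum 𝕜 (Γ.adjMatrix 𝕜) := by
  ext l
  rw [spectrum.mem_iff, Set.mem_range]
  constructor
  · rintro ⟨i, rfl⟩ hu
    refine h.idempotent_ne_zero hcard (θ := θ) i (hu.mul_right_eq_zero.1 ?_)
    rw [sub_mul, h.adj_mul_idempotent hθ, Algebra.algebraMap_eq_smul_one, smul_mul_assoc, one_mul,
      sub_self]
  · intro hu
    by_contra! hne
    refine hu (IsUnit.of_mul_eq_one (∑ i, (l - eigenvalue k θ i)⁻¹ • idempotent Γ k ε θ i) ?_)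
    rw [Finset.mul_sum, ← sum_idempotent Γ k ε θ]
    refine Finset.sum_congr rfl fun i _ => ?_
    rw [mul_smul_comm, sub_mul, h.adj_mul_idempotent hθ, Algebra.algebraMap_eq_smul_one,
      smul_mul_assoc, one_mul, ← sub_smul, smul_smul,
      inv_mul_cancel₀ (sub_ne_zero.2 (hne i).symm), one_smul]

end

end SimpleGraph.IsDesignGraph

/-! ### Krein parameters and `Q`-polynomial orderings -/

namespace SimpleGraph.IsDesignGraph

variable {V : Type*} {Γ : SimpleGraph V} {k μ : ℕ} {ε : V → ℤ}

open scoped Classical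

/-- The Krein parameters for the ordering `k, θ, -θ, -k` of the eigenvalues, where `U` is the
number of vertices. -/
def kreinParameter {𝕜 : Type*} [Field 𝕜] (U : 𝕜) (k : ℕ) (θ : 𝕜) :
    Fin 4 → Fin 4 → Fin 4 → 𝕜 :=
  let p := (U / 2 - 2 + (U / 2 - 2 * k) / θ) / 2
  let m := (U / 2 - 2 - (U / 2 - 2 * k) / θ) / 2
  ![![![1, 0, 0, 0], ![0, 1, 0, 0], ![0, 0, 1, 0], ![0, 0, 0, 1]],
    ![![0, 1, 0, 0], ![U / 2 - 1, p, m, 0], ![0, m, p, U / 2 - 1], ![0, 0, 1, 0]],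
    ![![0, 0, 1, 0], ![0, m, p, U / 2 - 1], ![U / 2 - 1, p, m, 0], ![0, 1, 0, 0]],
    ![![0, 0, 0, 1], ![0, 0, 1, 0], ![0, 1, 0, 0], ![1, 0, 0, 0]]]

variable [Fintype V] (h : Γ.IsDesignGraph k μ ε)
include h

/-- The Krein parameters `q 1 1 1` and `q 1 1 2`, doubled here, are positive, since `|θ| ≥ 1` and
`|U / 2 - 2 k| < U / 2 - 2`. The bound on the number `U` of vertices, which expresses that the graph
is not antipodal, is needed for one of them. -/
theorem krein_pos (hcard : 2 * k + 4 ≤ Fintype.card V) {θ : ℝ} (hθ : θ ^ 2 = k - μ) :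
    0 < (Fintype.card V / 2 - 2 + (Fintype.card V / 2 - 2 * k) / θ : ℝ) ∧
    0 < (Fintype.card V / 2 - 2 - (Fintype.card V / 2 - 2 * k) / θ : ℝ) := by
  have hk : (2 : ℝ) ≤ k := by exact_mod_cast h.two_le
  have hc : (2 * k + 4 : ℝ) ≤ Fintype.card V := by exact_mod_cast hcard
  have hlt : (μ + 1 : ℝ) ≤ k := by exact_mod_cast h.lt
  have h1 : 1 ≤ |θ| := by
    rw [← one_le_sq_iff_one_le_abs, hθ]; linarith
  have h2 : |(Fintype.card V / 2 - 2 * k : ℝ)| < Fintype.card V / 2 - 2 := by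
    rw [abs_lt]; constructor <;> linarith
  have h3 : |(Fintype.card V / 2 - 2 * k : ℝ) / θ| < Fintype.card V / 2 - 2 := by
    rw [abs_div]
    exact (div_le_self (abs_nonneg _) h1).trans_lt h2
  rw [abs_lt] at h3
  constructor <;> linarith

theorem isKreinParameters {θ : ℂ} (hθ : θ ^ 2 = k - μ) :
    IsKreinParameters (idempotent Γ k ε θ) (kreinParameter (Fintype.card V : ℂ) k θ) := by
  have hU := h.card_ne_zero ℂ
  have hθ0 := h.theta_ne_zero hθ
  have hc := h.card_eq ℂ
  -- The quadratic relation behind the squares of the second idempotent.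
  have hrel : (k : ℂ) * (Fintype.card V - 2 * k) = θ ^ 2 * (Fintype.card V - 2) := by
    rw [hθ]; linear_combination -2 * hc
  intro i j
  ext x y
  set E := fun i => idempotent Γ k ε θ i x y with hE
  set K := signMatrix ℂ ε x y with hK
  have h0 : E 0 = (Fintype.card V : ℂ)⁻¹ := by simp [hE, idempotent, onesMatrix]
  have h3 : E 3 = K * E 0 := by rw [h0]; simp [hE, idempotent, hK, mul_comm]
  -- The entries at the distances `0` and `2`, then at the distances `1` and `3`.
  have hcases : (K = 1 ∧ (E 1 = 2⁻¹ * (1 - 2 / Fintype.card V) ∨ E 1 = - 1 / Fintype.card V) ∧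
        E 2 = E 1) ∨
      (K = -1 ∧ (E 1 = (1 - 2 * k / Fintype.card V) / (2 * θ) ∨
        E 1 = (- k / Fintype.card V) / θ) ∧ E 2 = - E 1) := by
    have hs : ε x = ε y → K = 1 := fun hs => by
      simp only [hK, signMatrix, Matrix.of_apply, hs, h.sign_sq, Int.cast_one]
    have hs' : ε x ≠ ε y → K = -1 := fun hs => by
      have hs' : ε x * ε y = -1 := by
        rcases h.sign_eq x with h1 | h1 <;> rcases h.sign_eq y with h2 | h2 <;> simp_all
      simp only [hK, signMatrix, Matrix.of_apply, hs', Int.cast_neg, Int.cast_one]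
    have e1 : E 1 = 2⁻¹ * ((1 : Matrix V V ℂ) x y - (Fintype.card V : ℂ)⁻¹ * (1 + K) +
        θ⁻¹ * (Γ.adjMatrix ℂ x y - k * (Fintype.card V : ℂ)⁻¹ * (1 - K))) := by
      simp [hE, idempotent, restOne, restAdj, onesMatrix, hK]
      ring
    have e2 : E 2 = 2⁻¹ * ((1 : Matrix V V ℂ) x y - (Fintype.card V : ℂ)⁻¹ * (1 + K) -
        θ⁻¹ * (Γ.adjMatrix ℂ x y - k * (Fintype.card V : ℂ)⁻¹ * (1 - K))) := by
      simp [hE, idempotent, restOne, restAdj, onesMatrix, hK]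
      ring
    rw [e1, e2]
    by_cases hxy : x = y
    · subst hxy
      left
      rw [hs rfl]
      refine ⟨rfl, Or.inl ?_, ?_⟩
      · simp [adjMatrix_apply]
        ring
      · simp [adjMatrix_apply]
    by_cases ha : Γ.Adj x y
    · right
      have := h.sign_adj x y ha
      have := h.sign_eq x
      rw [hs' (by omega)]
      refine ⟨rfl, Or.inl ?_, ?_⟩
      · simp [adjMatrix_apply, hxy, ha]
        field_simp
        ring
      · simp [adjMatrix_apply, hxy, ha]
    by_cases he : ε x = ε y
    · left
      rw [hs he]
      refine ⟨rfl, Or.inr ?_, ?_⟩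
      · simp [adjMatrix_apply, hxy, ha]
        ring
      · simp [adjMatrix_apply, hxy, ha]
    · right
      rw [hs' he]
      refine ⟨rfl, Or.inr ?_, ?_⟩
      · simp [adjMatrix_apply, hxy, ha]
        field_simp
        ring
      · simp [adjMatrix_apply, hxy, ha]
  have h2 : E 2 = K * E 1 := by
    rcases hcases with ⟨hk, -, h⟩ | ⟨hk, -, h⟩ <;> rw [h, hk] <;> ring
  have hKK : K * K = 1 := by
    rcases hcases with ⟨hk, -, h⟩ | ⟨hk, -, h⟩ <;> rw [hk] <;> ring
  set p : ℂ := (Fintype.card V / 2 - 2 + (Fintype.card V / 2 - 2 * k) / θ) / 2 with hp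
  set m : ℂ := (Fintype.card V / 2 - 2 - (Fintype.card V / 2 - 2 * k) / θ) / 2 with hm
  have h11 : E 1 * E 1 =
      (Fintype.card V : ℂ)⁻¹ * ((Fintype.card V / 2 - 1) * E 0 + p * E 1 + m * E 2) := by
    rw [h0]
    rcases hcases with ⟨-, h1 | h1, h2⟩ | ⟨-, h1 | h1, h2⟩ <;> rw [h2, h1, hp, hm] <;> field_simp
    · ring
    · ring
    · linear_combination 4 * hrel
    · linear_combination 2 * hrel
  have hgoal : E i * E j = (Fintype.card V : ℂ)⁻¹ *
      ∑ l, kreinParameter (Fintype.card V : ℂ) k θ i j l * E l := by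
    rw [h0, h2] at h11
    rw [h0] at h3
    fin_cases i <;> fin_cases j <;>
      simp only [Fin.sum_univ_four, kreinParameter, Fin.zero_eta, Fin.mk_one, Fin.reduceFinMk,
        Matrix.cons_val, ← hp, ← hm, h0, h2, h3] <;>
    first
    | ring1
    | linear_combination h11
    | linear_combination K * h11 + (Fintype.card V : ℂ)⁻¹ * m * E 1 * hKK
    | linear_combination h11 + E 1 * E 1 * hKK
    | linear_combination (Fintype.card V : ℂ)⁻¹ * E 1 * hKK
    | linear_combination (Fintype.card V : ℂ)⁻¹ * (Fintype.card V : ℂ)⁻¹ * hKK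
  simpa [Matrix.sum_apply] using hgoal

omit [Fintype V] in
/-- The distance matrices are combinations of the identity, adjacency, all-ones and
sign matrices. -/
theorem distMatrix_eq :
    Γ.distMatrix 0 = 1 ∧ Γ.distMatrix 1 = Γ.adjMatrix ℂ ∧
    Γ.distMatrix 2 = (2⁻¹ : ℂ) • (onesMatrix V ℂ + signMatrix ℂ ε) - 1 ∧
    Γ.distMatrix 3 = (2⁻¹ : ℂ) • (onesMatrix V ℂ - signMatrix ℂ ε) - Γ.adjMatrix ℂ := by
  have hs : ∀ x y, ε x = ε y → signMatrix ℂ ε x y = 1 := fun x y hs => by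
    simp only [signMatrix, Matrix.of_apply, hs, h.sign_sq, Int.cast_one]
  have hs' : ∀ x y, ε x ≠ ε y → signMatrix ℂ ε x y = -1 := fun x y hs => by
    have hs' : ε x * ε y = -1 := by
      rcases h.sign_eq x with h1 | h1 <;> rcases h.sign_eq y with h2 | h2 <;> simp_all
    simp only [signMatrix, Matrix.of_apply, hs', Int.cast_neg, Int.cast_one]
  refine ⟨?_, ?_, ?_, ?_⟩ <;> ext x y
  · simp [distMatrix, h.connected.dist_eq_zero_iff, Matrix.one_apply]
  · simp [distMatrix, adjMatrix_apply]
  · simp only [distMatrix, h.dist_two, Matrix.of_apply, Matrix.sub_apply, Matrix.smul_apply,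
      Matrix.add_apply, onesMatrix, Matrix.one_apply, smul_eq_mul]
    by_cases hxy : x = y
    · subst hxy; simp [hs]; norm_num
    · by_cases he : ε x = ε y
      · simp [hxy, he, hs x y he]; norm_num
      · simp [hxy, he, hs' x y he]
  · simp only [distMatrix, h.dist_three, Matrix.of_apply, Matrix.sub_apply, Matrix.smul_apply,
      adjMatrix_apply, onesMatrix, smul_eq_mul]
    by_cases ha : Γ.Adj x y
    · have := h.sign_adj x y ha
      have := h.sign_eq x
      have := hs' x y (by omega)
      simp [ha, this]; norm_num
    · by_cases he : ε x = ε y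
      · simp [ha, he, hs x y he]
      · simp [ha, he, hs' x y he]; norm_num

theorem span_idempotent {θ : ℂ} (hθ : θ ^ 2 = k - μ) :
    Submodule.span ℂ (Set.range (idempotent Γ k ε θ)) = Γ.boseMesner := by
  have hU := h.card_ne_zero ℂ
  obtain ⟨d0, d1, d2, d3⟩ := h.distMatrix_eq
  have hmem : ∀ i ≤ 3, Γ.distMatrix i ∈ Γ.boseMesner := fun i hi =>
    Submodule.subset_span ⟨⟨i, by rw [h.diam_eq]; omega⟩, rfl⟩
  have hE : ∀ i, idempotent Γ k ε θ i ∈ Submodule.span ℂ (Set.range (idempotent Γ k ε θ)) :=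
    fun i => Submodule.subset_span ⟨i, rfl⟩
  apply le_antisymm
  · have m0 := hmem 0 (by norm_num)
    have m1 := hmem 1 (by norm_num)
    have m2 := hmem 2 (by norm_num)
    have m3 := hmem 3 (by norm_num)
    have hJ : onesMatrix V ℂ ∈ Γ.boseMesner := by
      have : onesMatrix V ℂ = Γ.distMatrix 0 + Γ.distMatrix 1 + Γ.distMatrix 2 +
          Γ.distMatrix 3 := by rw [d0, d1, d2, d3]; module
      rw [this]
      exact add_mem (add_mem (add_mem m0 m1) m2) m3
    have hK : signMatrix ℂ ε ∈ Γ.boseMesner := by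
      have : signMatrix ℂ ε = Γ.distMatrix 0 - Γ.distMatrix 1 + Γ.distMatrix 2 -
          Γ.distMatrix 3 := by rw [d0, d1, d2, d3]; module
      rw [this]
      exact sub_mem (add_mem (sub_mem m0 m1) m2) m3
    rw [d0] at m0
    rw [d1] at m1
    have hR : restOne V ℂ ε ∈ Γ.boseMesner :=
      sub_mem m0 (Submodule.smul_mem _ _ (add_mem hJ hK))
    have hX : restAdj Γ k ε θ ∈ Γ.boseMesner :=
      Submodule.smul_mem _ _ (sub_mem m1 (Submodule.smul_mem _ _ (sub_mem hJ hK)))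
    rw [Submodule.span_le]
    rintro _ ⟨i, rfl⟩
    fin_cases i
    · exact Submodule.smul_mem _ _ hJ
    · exact Submodule.smul_mem _ _ (add_mem hR hX)
    · exact Submodule.smul_mem _ _ (sub_mem hR hX)
    · exact Submodule.smul_mem _ _ hK
  · have m0 : (1 : Matrix V V ℂ) ∈ Submodule.span ℂ (Set.range (idempotent Γ k ε θ)) := by
      rw [← sum_idempotent Γ k ε θ]
      exact sum_mem fun i _ => hE i
    have m1 : Γ.adjMatrix ℂ ∈ Submodule.span ℂ (Set.range (idempotent Γ k ε θ)) := by
      rw [← h.sum_eigenvalue_smul_idempotent hθ]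
      exact sum_mem fun i _ => Submodule.smul_mem _ _ (hE i)
    have hJ : onesMatrix V ℂ ∈ Submodule.span ℂ (Set.range (idempotent Γ k ε θ)) := by
      have := Submodule.smul_mem _ (Fintype.card V : ℂ) (hE 0)
      simpa [idempotent, smul_smul, hU] using this
    have hK : signMatrix ℂ ε ∈ Submodule.span ℂ (Set.range (idempotent Γ k ε θ)) := by
      have := Submodule.smul_mem _ (Fintype.card V : ℂ) (hE 3)
      simpa [idempotent, smul_smul, hU] using this
    unfold boseMesner
    rw [Submodule.span_le]
    rintro _ ⟨⟨i, hi⟩, rfl⟩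
    rw [h.diam_eq] at hi
    change Γ.distMatrix i ∈ _
    interval_cases i
    · rwa [d0]
    · rwa [d1]
    · rw [d2]; exact sub_mem (Submodule.smul_mem _ _ (add_mem hJ hK)) m0
    · rw [d3]; exact sub_mem (Submodule.smul_mem _ _ (sub_mem hJ hK)) m1

/-- The ordering `k, √(k - μ), -√(k - μ), -k` is `Q`-polynomial. -/
theorem isQPolynomialOrdering (hcard : 2 * k + 4 ≤ Fintype.card V) :
    Γ.IsQPolynomialOrdering (eigenvalue k √((k : ℝ) - μ)) := by
  have hlt : (μ : ℝ) < k := by exact_mod_cast h.lt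
  have hμ : (0 : ℝ) < μ := by exact_mod_cast h.pos
  have hk : (2 : ℝ) ≤ k := by exact_mod_cast h.two_le
  set θ : ℝ := √((k : ℝ) - μ) with hθ_def
  have hθ0 : 0 < θ := Real.sqrt_pos.2 (by linarith)
  have hθ : θ ^ 2 = k - μ := Real.sq_sqrt (by linarith)
  have hθk : θ < k := by nlinarith
  have hθc : (θ : ℂ) ^ 2 = k - μ := by exact_mod_cast congrArg (Complex.ofReal) hθ
  have heig : ∀ i, ((eigenvalue k θ i : ℝ) : ℂ) = eigenvalue k (θ : ℂ) i := by
    intro i; fin_cases i <;> simp [eigenvalue]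
  refine ⟨h.diam_eq, ?_, h.spectrum_eq hcard hθ, ?_,
    idempotent Γ k ε (θ : ℂ), kreinParameter (Fintype.card V : ℂ) k (θ : ℂ), ?_,
    h.isKreinParameters hθc, ?_, ?_⟩
  · intro i j hij
    fin_cases i <;> fin_cases j <;> simp [eigenvalue] at hij ⊢ <;>
      first
      | linarith
      | (have := h.two_le; omega)
  · intro i
    fin_cases i <;> simp [eigenvalue] <;> linarith
  · exact ⟨h.span_idempotent hθc, h.idempotent_ne_zero hcard, h.idempotent_mul hθc,
      sum_idempotent _ _ _ _, rfl, fun i => by rw [h.adj_mul_idempotent hθc, heig]⟩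
  · intro i j l
    fin_cases i <;> fin_cases j <;> fin_cases l <;> simp [kreinParameter]
  · obtain ⟨-, hm⟩ := h.krein_pos hcard hθ
    have hm' : ((Fintype.card V : ℂ) / 2 - 2 - (Fintype.card V / 2 - 2 * k) / θ) / 2 ≠ 0 := by
      have : (((Fintype.card V / 2 - 2 - (Fintype.card V / 2 - 2 * k) / θ : ℝ)) : ℂ) ≠ 0 :=
        Complex.ofReal_ne_zero.2 hm.ne'
      push_cast at this
      exact div_ne_zero this two_ne_zero
    have hq : (Fintype.card V : ℂ) / 2 - 1 ≠ 0 := by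
      intro h0
      have h1 : (Fintype.card V : ℂ) = 2 := by linear_combination 2 * h0
      have h2 : Fintype.card V = 2 := by exact_mod_cast h1
      omega
    intro i j l hl
    fin_cases i <;> fin_cases j <;> fin_cases l <;> simp at hl <;>
      simp only [kreinParameter, Fin.zero_eta, Fin.mk_one, Fin.reduceFinMk, Matrix.cons_val] <;>
      first
      | exact one_ne_zero
      | exact hm'
      | exact hq

/-- In a `Q`-polynomial ordering the second eigenvalue is `√(k - μ)` or its negative: the
eigenvalue `-k` is impossible there, because the entrywise square of its idempotent has constant
columns. -/
theorem sq_eq_of_isQPolynomialOrdering (hcard : 2 * k + 4 ≤ Fintype.card V) {σ : Fin 4 → ℝ}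
    (hσ : Γ.IsQPolynomialOrdering σ) : σ 1 ^ 2 = k - μ := by
  have hlt : (μ : ℝ) < k := by exact_mod_cast h.lt
  have hk : (2 : ℝ) ≤ k := by exact_mod_cast h.two_le
  have hU := h.card_ne_zero ℂ
  have hθ : √((k : ℝ) - μ) ^ 2 = k - μ := Real.sq_sqrt (by linarith)
  have hrange := (h.spectrum_eq hcard hθ).trans hσ.range_eq.symm
  have h0 : σ 0 = k := by
    obtain ⟨i, hi⟩ : (k : ℝ) ∈ Set.range σ := hrange ▸ ⟨0, rfl⟩
    refine le_antisymm ?_ (hi ▸ hσ.greatest i)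
    obtain ⟨j, hj⟩ : σ 0 ∈ Set.range (eigenvalue k √((k : ℝ) - μ)) := hrange ▸ ⟨0, rfl⟩
    have := Real.sqrt_nonneg ((k : ℝ) - μ)
    rw [← hj]
    have hμ : (0 : ℝ) < μ := by exact_mod_cast h.pos
    fin_cases j <;> simp [eigenvalue] <;> nlinarith
  obtain ⟨j, hj⟩ : σ 1 ∈ Set.range (eigenvalue k √((k : ℝ) - μ)) := hrange ▸ ⟨1, rfl⟩
  have h1 : σ 1 ≠ k := by rw [← h0]; exact hσ.injective.ne (by decide)
  suffices h2 : σ 1 ≠ -k by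
    fin_cases j <;> simp [eigenvalue] at hj
    · exact absurd hj.symm h1
    · rw [← hj, hθ]
    · rw [← hj, neg_sq, hθ]
    · exact absurd hj.symm h2
  intro h2
  obtain ⟨E, q, hE, hq, -, hq2⟩ := hσ.krein
  have hAE := hE.adj_mul 1
  rw [h2] at hAE
  -- The columns of `E 1` are multiples of the sign vector.
  have hJE : onesMatrix V ℂ * E 1 = 0 := by
    have := Matrix.mul_assoc (onesMatrix V ℂ) (Γ.adjMatrix ℂ) (E 1)
    rw [h.ones_mul_adj, hAE, Matrix.smul_mul, Matrix.mul_smul] at this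
    have h3 : (2 * (k : ℂ)) • (onesMatrix V ℂ * E 1) = 0 := by
      rw [two_mul, add_smul]
      nth_rewrite 1 [this]
      push_cast
      module
    exact (smul_eq_zero.1 h3).resolve_left (mul_ne_zero two_ne_zero (h.cast_k_ne_zero ℂ))
  have hKE : (Fintype.card V : ℂ) • E 1 = signMatrix ℂ ε * E 1 := by
    have h3 := Matrix.mul_assoc (Γ.adjMatrix ℂ) (Γ.adjMatrix ℂ) (E 1)
    rw [h.adj_mul_adj, hAE, Matrix.mul_smul, hAE, add_mul, smul_mul_assoc, smul_mul_assoc,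
      add_mul, hJE, one_mul, zero_add, smul_smul] at h3
    have hμ : (μ : ℂ) ≠ 0 := by exact_mod_cast h.pos.ne'
    have h4 : ((μ : ℂ) / 2) • (signMatrix ℂ ε * E 1) = ((k : ℂ) ^ 2 - (k - μ)) • E 1 := by
      rw [sub_smul, ← sub_eq_iff_eq_add'.2 h3.symm]
      push_cast
      module
    rw [h.card_eq ℂ] at h4
    have h5 : (μ : ℂ) / 2 ≠ 0 := div_ne_zero hμ two_ne_zero
    apply smul_right_injective _ h5
    simp only [smul_smul]
    rw [h4]
    congr 1
    ring
  have hcol : Matrix.hadamard (E 1) (E 1) =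
      (Fintype.card V : ℂ)⁻¹ • (onesMatrix V ℂ * Matrix.hadamard (E 1) (E 1)) := by
    have h3 : ∀ x z, (Fintype.card V : ℂ) ^ 2 * (E 1 x z * E 1 x z) =
        (∑ w, (ε w : ℂ) * E 1 w z) ^ 2 := by
      intro x z
      have h4 := congrFun (congrFun hKE x) z
      simp only [Matrix.smul_apply, smul_eq_mul, Matrix.mul_apply, signMatrix, Matrix.of_apply,
        Int.cast_mul, mul_assoc, ← Finset.mul_sum] at h4
      have h5 : (ε x : ℂ) * ε x = 1 := by exact_mod_cast h.sign_sq x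
      linear_combination ((Fintype.card V : ℂ) * E 1 x z + ε x * ∑ w, (ε w : ℂ) * E 1 w z) * h4 +
        (∑ w, (ε w : ℂ) * E 1 w z) ^ 2 * h5
    have h4 : ∀ x y z, E 1 x z * E 1 x z = E 1 y z * E 1 y z := fun x y z =>
      mul_left_cancel₀ (pow_ne_zero 2 hU) ((h3 x z).trans (h3 y z).symm)
    ext x z
    simp only [Matrix.smul_apply, Matrix.mul_apply, Matrix.hadamard_apply, onesMatrix,
      Matrix.of_apply, one_mul, smul_eq_mul, h4 _ x z]
    simp [hU]
  have hEJ : E 2 * onesMatrix V ℂ = 0 := by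
    have h3 : onesMatrix V ℂ = (Fintype.card V : ℂ) • E 0 := by
      rw [hE.zero_eq, smul_smul, mul_inv_cancel₀ hU, one_smul]; rfl
    rw [h3, mul_smul_comm, hE.mul_eq, if_neg (by decide), smul_zero]
  have h3 : E 2 * Matrix.hadamard (E 1) (E 1) = 0 := by
    rw [hcol, mul_smul_comm, ← mul_assoc, hEJ, zero_mul, smul_zero]
  rw [hq 1 1, mul_smul_comm, Finset.mul_sum] at h3
  simp only [mul_smul_comm, hE.mul_eq, smul_ite, smul_zero, Finset.sum_ite_eq, Finset.mem_univ,
    if_true] at h3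
  rw [smul_smul] at h3
  rcases mul_eq_zero.1 ((smul_eq_zero.1 h3).resolve_right (hE.ne_zero 2)) with h4 | h4
  · exact inv_ne_zero hU h4
  · exact hq2 1 1 2 rfl h4

end SimpleGraph.IsDesignGraph

/-! ### Antipodal double covers of complete graphs -/

namespace SimpleGraph

/-- `Γ` is a distance-regular double cover of a complete graph: `π` is the involution interchanging
the two points of each fibre, each vertex has `k` neighbours, and two vertices in different fibres
have `a` common neighbours if they are adjacent and `c` otherwise. -/
structure IsDoubleCover {V : Type*} (Γ : SimpleGraph V) (π : V → V) (k a c : ℕ) : Prop where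
  nonempty : Nonempty V
  invol : ∀ x, π (π x) = x
  ne : ∀ x, π x ≠ x
  not_adj : ∀ x, ¬ Γ.Adj x (π x)
  adj_iff : ∀ x y, y ≠ x → y ≠ π x → (Γ.Adj x (π y) ↔ ¬ Γ.Adj x y)
  ncard_nbrs : ∀ x, {z | Γ.Adj x z}.ncard = k
  ncard_of_adj : ∀ x y, Γ.Adj x y → {z | Γ.Adj x z ∧ Γ.Adj y z}.ncard = a
  ncard_of_not_adj : ∀ x y, y ≠ x → y ≠ π x → ¬ Γ.Adj x y →
    {z | Γ.Adj x z ∧ Γ.Adj y z}.ncard = c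
  k_pos : 0 < k
  a_pos : 0 < a
  c_pos : 0 < c

namespace IsDoubleCover

variable {V : Type*} {Γ : SimpleGraph V} {π : V → V} {k a c : ℕ} (h : Γ.IsDoubleCover π k a c)
include h

theorem no_common (x z : V) (h1 : Γ.Adj x z) (h2 : Γ.Adj (π x) z) : False := by
  refine (h.adj_iff z x h1.ne ?_).1 h2.symm h1.symm
  rintro rfl
  exact h.not_adj _ h1.symm

theorem exists_walk_two {x y : V} (h1 : y ≠ x) (h2 : y ≠ π x) (h3 : ¬ Γ.Adj x y) :
    ∃ p : Γ.Walk x y, p.length = 2 := by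
  have h4 := h.ncard_of_not_adj x y h1 h2 h3
  have h5 := h.c_pos
  obtain ⟨z, hz1, hz2⟩ := Set.nonempty_of_ncard_ne_zero (by omega :
    {z | Γ.Adj x z ∧ Γ.Adj y z}.ncard ≠ 0)
  exact ⟨.cons hz1 (.cons hz2.symm .nil), rfl⟩

theorem exists_walk_three (x : V) : ∃ p : Γ.Walk x (π x), p.length = 3 := by
  have h4 := h.ncard_nbrs x
  have h5 := h.k_pos
  obtain ⟨w, hw⟩ := Set.nonempty_of_ncard_ne_zero (by omega : {z | Γ.Adj x z}.ncard ≠ 0)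
  change Γ.Adj x w at hw
  obtain ⟨p, hp⟩ := h.exists_walk_two (x := w) (y := π x)
    (by rintro rfl; exact h.not_adj _ hw)
    (by intro he; apply hw.ne; rw [← h.invol x, he, h.invol])
    (fun ha => h.no_common x w hw ha.symm)
  exact ⟨.cons hw p, by simp [hp]⟩

theorem connected : Γ.Connected := by
  have := h.nonempty
  refine ⟨fun x y => ?_⟩
  by_cases h1 : y = x
  · subst h1; exact Reachable.refl _
  by_cases h2 : y = π x
  · subst h2; exact ⟨(h.exists_walk_three x).choose⟩
  by_cases h3 : Γ.Adj x y
  · exact h3.reachable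
  · exact ⟨(h.exists_walk_two h1 h2 h3).choose⟩

open scoped Classical in
theorem dist_eq (x y : V) : Γ.dist x y =
    if y = x then 0 else if Γ.Adj x y then 1 else if y = π x then 3 else 2 := by
  split_ifs with h1 h2 h3
  · rw [h1, dist_self]
  · exact dist_eq_one_iff_adj.2 h2
  · subst h3
    obtain ⟨p, hp⟩ := h.exists_walk_three x
    have h4 := hp ▸ dist_le p
    have h5 := h.connected.one_lt_dist_of_ne_of_not_adj (h.ne x).symm (h.not_adj x)
    have h6 : Γ.dist x (π x) ≠ 2 := by
      intro h6
      obtain ⟨q, hq⟩ := h.connected.exists_walk_length_eq_dist x (π x)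
      rw [h6] at hq
      have h7 := h.no_common x
      generalize π x = y at q h7
      match q, hq with
      | .cons h₁ (.cons h₂ .nil), _ => exact h7 _ h₁ h₂.symm
    omega
  · obtain ⟨p, hp⟩ := h.exists_walk_two h1 h3 h2
    have h4 := hp ▸ dist_le p
    have h5 := h.connected.one_lt_dist_of_ne_of_not_adj (Ne.symm h1) h2
    omega

theorem dist_eq_zero_or_three (x y : V) : (Γ.dist x y = 0 ∨ Γ.dist x y = 3) ↔ y = x ∨ y = π x := by
  classical
  rw [h.dist_eq]
  have := h.not_adj x
  split_ifs with h1 h2 h3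
  · simp [h1]
  · have : y ≠ π x := by rintro rfl; exact h.not_adj x h2
    simp [h1, this]
  · simp [h3]
  · simp [h1, h3]

theorem dist_le_three (x y : V) : Γ.dist x y ≤ 3 := by
  classical
  rw [h.dist_eq]; split_ifs <;> omega

theorem dist_antipode (x y : V) : Γ.dist (π x) y = 3 - Γ.dist x y := by
  classical
  rw [h.dist_eq, h.dist_eq, h.invol]
  have h0 := h.ne x
  have h1 := h.not_adj x
  by_cases hy : y = x
  · subst hy
    have : ¬ Γ.Adj (π y) y := fun ha => h1 ha.symm
    simp [h0.symm, this]
  by_cases hy' : y = π x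
  · subst hy'; simp [h1, h0]
  have h2 : Γ.Adj (π x) y ↔ ¬ Γ.Adj x y := by
    rw [Γ.adj_comm, Γ.adj_comm x]
    refine h.adj_iff y x (Ne.symm hy) ?_
    rintro rfl
    exact hy' (h.invol y).symm
  by_cases h3 : Γ.Adj x y <;> simp [hy, hy', h2, h3]

theorem exists_ncard_common : ∃ p : ℕ → ℕ, ∀ x y,
    {z | Γ.dist x z = 1 ∧ Γ.Adj y z}.ncard = p (Γ.dist x y) := by
  classical
  refine ⟨fun d => if d = 0 then k else if d = 1 then a else if d = 2 then c else 0,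
    fun x y => ?_⟩
  simp only [dist_eq_one_iff_adj]
  rw [h.dist_eq]
  by_cases h1 : y = x
  · subst h1; simpa using h.ncard_nbrs y
  by_cases h2 : Γ.Adj x y
  · simpa [h1, h2] using h.ncard_of_adj x y h2
  by_cases h3 : y = π x
  · subst h3
    rw [if_neg h1, if_neg h2, if_pos rfl]
    rw [if_neg (by decide), if_neg h2, if_neg (by decide)]
    convert Set.ncard_empty V
    ext z
    simpa using h.no_common x z
  · simpa [h1, h2, h3] using h.ncard_of_not_adj x y h1 h3 h2

theorem exists_ncard_zero : ∃ p : ℕ → ℕ, ∀ x y,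
    {z | Γ.dist x z = 0 ∧ Γ.Adj y z}.ncard = p (Γ.dist x y) := by
  refine ⟨fun d => if d = 1 then 1 else 0, fun x y => ?_⟩
  have h0 : {z | Γ.dist x z = 0 ∧ Γ.Adj y z} = {z | z = x ∧ Γ.dist x y = 1} := by
    ext z
    simp only [Set.mem_ofPred_eq, h.connected.dist_eq_zero_iff, dist_eq_one_iff_adj, Γ.adj_comm y]
    constructor <;> rintro ⟨rfl, h⟩ <;> exact ⟨rfl, h⟩
  rw [h0]
  by_cases h1 : Γ.dist x y = 1 <;> simp [h1]

theorem isDistanceRegular : Γ.IsDistanceRegular := by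
  have key : ∀ j, ∃ p : ℕ → ℕ, ∀ x y, {z | Γ.dist x z = j ∧ Γ.Adj y z}.ncard = p (Γ.dist x y) := by
    intro j
    -- Distances `2` and `3` from `x` are distances `1` and `0` from the antipode of `x`.
    have hanti : ∀ x z i, i ≤ 3 → (Γ.dist x z = i ↔ Γ.dist (π x) z = 3 - i) := by
      intro x z i hi
      have := h.dist_antipode x z
      have := h.dist_le_three x z
      omega
    obtain ⟨p₀, hp₀⟩ := h.exists_ncard_zero
    obtain ⟨p₁, hp₁⟩ := h.exists_ncard_common
    match j with
    | 0 => exact ⟨p₀, hp₀⟩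
    | 1 => exact ⟨p₁, hp₁⟩
    | 2 =>
      refine ⟨fun i => p₁ (3 - i), fun x y => ?_⟩
      simp only [hanti x _ 2 (by omega), ← h.dist_antipode]
      exact hp₁ _ _
    | 3 =>
      refine ⟨fun i => p₀ (3 - i), fun x y => ?_⟩
      simp only [hanti x _ 3 (by omega), ← h.dist_antipode]
      exact hp₀ _ _
    | j + 4 =>
      refine ⟨fun _ => 0, fun x y => ?_⟩
      convert Set.ncard_empty V
      ext z
      have := h.dist_le_three x z
      simp only [Set.mem_ofPred_eq, Set.mem_empty_iff_false, iff_false, not_and]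
      omega
  choose p hp using key
  refine ⟨h.connected, fun i => if i = 0 then 0 else p (i - 1) i, fun i => p i i,
    fun i => p (i + 1) i, fun x y => ⟨?_, hp _ x y, hp _ x y⟩⟩
  beta_reduce
  split_ifs with h0
  · simp [h0]
  · rw [← hp]
    congr 1
    ext z
    simp only [Set.mem_ofPred_eq]
    have : Γ.dist x z + 1 = Γ.dist x y ↔ Γ.dist x z = Γ.dist x y - 1 := by omega
    rw [this]

theorem diam_eq [Finite V] : Γ.diam = 3 := by
  classical
  have := h.nonempty
  obtain ⟨x, y, hxy⟩ := Γ.exists_dist_eq_diam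
  have h1 := h.dist_le_three x y
  obtain ⟨v⟩ := h.nonempty
  have h2 := dist_le_diam (connected_iff_ediam_ne_top.1 h.connected) (u := v) (v := π v)
  have h3 : Γ.dist v (π v) = 3 := by rw [h.dist_eq]; simp [h.ne, h.not_adj]
  omega

theorem isAntipodal [Finite V] : Γ.IsAntipodal := by
  unfold IsAntipodal
  simp only [h.diam_eq, h.dist_eq_zero_or_three]
  refine ⟨fun x => Or.inl rfl, ?_, ?_⟩
  · rintro x y (rfl | rfl)
    · exact Or.inl rfl
    · exact Or.inr (h.invol x).symm
  · rintro x y z (rfl | rfl) (rfl | rfl)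
    · exact Or.inl rfl
    · exact Or.inr rfl
    · exact Or.inr rfl
    · exact Or.inl (h.invol x)

/-- Adjacent vertices have a common neighbour, so there are triangles. -/
theorem not_isBipartite : ¬ Γ.IsBipartite := by
  rintro ⟨C⟩
  obtain ⟨x⟩ := h.nonempty
  have h1 := h.ncard_nbrs x
  have h2 := h.k_pos
  obtain ⟨y, hy⟩ := Set.nonempty_of_ncard_ne_zero (by omega : {z | Γ.Adj x z}.ncard ≠ 0)
  have h3 := h.ncard_of_adj x y hy
  have h4 := h.a_pos
  obtain ⟨z, hz1, hz2⟩ := Set.nonempty_of_ncard_ne_zero (by omega :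
    {z | Γ.Adj x z ∧ Γ.Adj y z}.ncard ≠ 0)
  have c1 := C.valid hy
  have c2 := C.valid hz1
  have c3 := C.valid hz2
  omega

end IsDoubleCover
end SimpleGraph

/-! ### Characters and character sums -/

namespace CyclicDecomposition

variable {G : Type*} [AddCommGroup G] (D : CyclicDecomposition G)

theorem char_comm (g x : G) : D.char g x = D.char x g := by
  simp only [char, mul_comm]

theorem char_add_right (g x y : G) : D.char g (x + y) = D.char g x * D.char g y := by
  simp only [char, ← Finset.prod_mul_distrib]
  refine Finset.prod_congr rfl fun i _ => ?_
  have : NeZero (D.n i) := ⟨(D.pos i).ne'⟩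
  rw [map_add, Pi.add_apply, ZMod.val_add, ← pow_add, ← mul_add, mul_comm, pow_mul,
    mul_comm _ (_ + _), pow_mul, ← pow_eq_pow_mod _ (D.primitive i).pow_eq_one]

theorem char_zero_right (g : G) : D.char g 0 = 1 := by
  simp [char, ZMod.val_zero]

theorem char_add_left (g h x : G) : D.char (g + h) x = D.char g x * D.char h x := by
  simp only [D.char_comm _ x, char_add_right]

theorem char_zero_left (x : G) : D.char 0 x = 1 := by
  rw [char_comm, char_zero_right]

theorem char_neg_left (g x : G) : D.char (-g) x = D.char g (-x) := by
  have h1 : D.char (-g) x * D.char g x = 1 := by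
    rw [← char_add_left, neg_add_cancel, char_zero_left]
  have h2 : D.char g x * D.char g (-x) = 1 := by
    rw [← char_add_right, add_neg_cancel, char_zero_right]
  calc _ = D.char (-g) x * (D.char g x * D.char g (-x)) := by rw [h2, mul_one]
    _ = _ := by rw [← mul_assoc, h1, one_mul]

/-- The pairing `(g, x) ↦ χ_g (x)` is nondegenerate. -/
theorem eq_zero_of_char_eq_one {g : G} (h : ∀ x, D.char g x = 1) : g = 0 := by
  classical
  apply D.equiv.injective
  rw [map_zero]
  ext i
  have : NeZero (D.n i) := ⟨(D.pos i).ne'⟩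
  by_cases h1 : D.n i = 1
  · have : Subsingleton (ZMod (D.n i)) := by rw [h1]; infer_instance
    exact Subsingleton.elim _ _
  have : Fact (1 < D.n i) := ⟨by have := D.pos i; omega⟩
  have h2 := h (D.equiv.symm (Pi.single i 1))
  rw [char, Finset.prod_eq_single i] at h2
  · simp only [AddEquiv.apply_symm_apply, Pi.single_eq_same, ZMod.val_one, mul_one] at h2
    have h3 := (D.primitive i).dvd_of_pow_eq_one _ h2
    exact (ZMod.val_eq_zero _).1 (Nat.eq_zero_of_dvd_of_lt h3 (ZMod.val_lt _))
  · intro j _ hj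
    simp [Pi.single_eq_of_ne hj, ZMod.val_zero]
  · simp

theorem eq_of_char_eq {g h : G} (hgh : ∀ x, D.char g x = D.char h x) : g = h := by
  rw [← sub_eq_zero]
  apply D.eq_zero_of_char_eq_one
  intro x
  rw [sub_eq_add_neg, char_add_left, hgh, ← char_add_left, add_neg_cancel, char_zero_left]

variable [Fintype G]

open scoped Classical

theorem sum_char (x : G) : ∑ g, D.char g x = if x = 0 then (Fintype.card G : ℂ) else 0 := by
  split_ifs with hx
  · simp [hx, char_zero_right]
  · obtain ⟨y, hy⟩ : ∃ y, D.char x y ≠ 1 := by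
      by_contra! hne
      exact hx (D.eq_zero_of_char_eq_one hne)
    have h1 : ∑ g, D.char g x = D.char x y * ∑ g, D.char g x := by
      rw [Finset.mul_sum, ← Equiv.sum_comp (Equiv.addRight y)]
      refine Finset.sum_congr rfl fun g _ => ?_
      rw [Equiv.coe_addRight, char_add_left, D.char_comm y x, mul_comm]
    have h2 : (D.char x y - 1) * ∑ g, D.char g x = 0 := by linear_combination -h1
    exact (mul_eq_zero.1 h2).resolve_left (sub_ne_zero.2 hy)

theorem charSum_zero (S : Set G) : D.charSum 0 S = S.ncard := by
  rw [charSum, show S.ncard = {x | x ∈ S}.ncard from rfl, Set.ncard_setOf_eq]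
  simp [char_zero_left]

theorem charSum_neg {S : Set G} (hS : IsConnectionSet S) (g : G) :
    D.charSum (-g) S = D.charSum g S := by
  unfold charSum
  refine Finset.sum_nbij' Neg.neg Neg.neg ?_ ?_ ?_ ?_ ?_
  · intro x hx; simpa using hS.2 x (by simpa using hx)
  · intro x hx; simpa using hS.2 x (by simpa using hx)
  · simp
  · simp
  · intro x _; rw [char_neg_left]

theorem sum_charSum {S : Set G} (hS : IsConnectionSet S) : ∑ g, D.charSum g S = 0 := by
  unfold charSum
  rw [Finset.sum_comm]
  refine Finset.sum_eq_zero fun s hs => ?_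
  rw [sum_char, if_neg]
  rintro rfl
  exact hS.1 (by simpa using hs)

/-- The character sums form an idempotent for convolution up to the factor `|G|`, being the
Fourier transform of an indicator function. -/
theorem sum_charSum_mul_charSum_sub (S : Set G) (x : G) :
    ∑ g, D.charSum g S * D.charSum (x - g) S = Fintype.card G * D.charSum x S := by
  have h1 : ∀ g, D.charSum g S * D.charSum (x - g) S =
      ∑ s : G with s ∈ S, ∑ t : G with t ∈ S, D.char x t * D.char g (s - t) := by
    intro g
    simp only [charSum, Finset.sum_mul_sum]
    refine Finset.sum_congr rfl fun s _ => Finset.sum_congr rfl fun t _ => ?_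
    rw [sub_eq_add_neg, char_add_left, char_neg_left, sub_eq_add_neg, char_add_right]
    ring
  simp only [h1]
  rw [Finset.sum_comm, charSum, Finset.mul_sum]
  refine Finset.sum_congr rfl fun s hs => ?_
  rw [Finset.sum_comm, Finset.sum_eq_single_of_mem s hs]
  · rw [← Finset.mul_sum, sum_char, if_pos (sub_self s), mul_comm]
  · intro t _ hts
    rw [← Finset.mul_sum, sum_char, if_neg (sub_ne_zero.2 hts.symm), mul_zero]

end CyclicDecomposition

/-! ### The character sums of a design graph -/

theorem addCayley_adj_iff {G : Type*} [AddCommGroup G] {S : Set G} (hS : IsConnectionSet S)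
    (x y : G) : (SimpleGraph.addCayley S).Adj x y ↔ y - x ∈ S := by
  rw [SimpleGraph.addCayley_adj, neg_add_eq_sub, neg_add_eq_sub]
  constructor
  · rintro ⟨-, h | h⟩
    · exact h
    · simpa using hS.2 _ h
  · intro h
    refine ⟨?_, Or.inl h⟩
    rintro rfl
    exact hS.1 (by simpa using h)

namespace SimpleGraph.IsDesignGraph

open scoped Matrix

open scoped Classical in
/-- An eigenvector is orthogonal to the constant vector unless its eigenvalue is `k`, and to the
sign vector unless its eigenvalue is `-k`; the formula for the square of the adjacency matrix then
restricts the eigenvalue. -/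
theorem eigenvector_equations {V : Type*} [Fintype V] {Γ : SimpleGraph V} {k μ : ℕ} {ε : V → ℤ}
    (h : Γ.IsDesignGraph k μ ε) {v : V → ℂ} {f : ℂ} (hA : Γ.adjMatrix ℂ *ᵥ v = f • v) :
    (f - k) * ∑ y, v y = 0 ∧ (f + k) * ∑ y, (ε y : ℂ) * v y = 0 ∧
    ∀ x, (f ^ 2 - (k - μ)) * v x = μ / 2 * (∑ y, v y + ε x * ∑ y, (ε y : ℂ) * v y) := by
  have hJ : ∀ x, (onesMatrix V ℂ *ᵥ v) x = ∑ y, v y := by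
    intro x; simp [Matrix.mulVec, dotProduct, onesMatrix]
  have hK : ∀ x, (signMatrix ℂ ε *ᵥ v) x = ε x * ∑ y, (ε y : ℂ) * v y := by
    intro x; simp [Matrix.mulVec, dotProduct, signMatrix, Finset.mul_sum, mul_assoc]
  obtain ⟨x₀⟩ := h.connected.nonempty
  refine ⟨?_, ?_, fun x => ?_⟩
  · have h1 := Matrix.mulVec_mulVec v (onesMatrix V ℂ) (Γ.adjMatrix ℂ)
    rw [hA, h.ones_mul_adj, Matrix.mulVec_smul, Matrix.smul_mulVec] at h1
    have h2 := congrFun h1 x₀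
    simp only [Pi.smul_apply, hJ, smul_eq_mul] at h2
    linear_combination h2
  · have h1 := Matrix.mulVec_mulVec v (signMatrix ℂ ε) (Γ.adjMatrix ℂ)
    rw [hA, h.sign_mul_adj, Matrix.mulVec_smul, Matrix.neg_mulVec, Matrix.smul_mulVec] at h1
    have h2 := congrFun h1 x₀
    simp only [Pi.smul_apply, Pi.neg_apply, hK, smul_eq_mul] at h2
    have h5 : (ε x₀ : ℂ) * ε x₀ = 1 := by exact_mod_cast h.sign_sq x₀
    linear_combination ε x₀ * h2 - (f + k) * (∑ y, (ε y : ℂ) * v y) * h5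
  · have h1 := Matrix.mulVec_mulVec v (Γ.adjMatrix ℂ) (Γ.adjMatrix ℂ)
    rw [hA, h.adj_mul_adj, Matrix.mulVec_smul, hA, Matrix.add_mulVec, Matrix.smul_mulVec,
      Matrix.smul_mulVec, Matrix.add_mulVec, Matrix.one_mulVec] at h1
    have h2 := congrFun h1 x
    simp only [Pi.smul_apply, Pi.add_apply, hJ, hK, smul_eq_mul] at h2
    linear_combination h2

open CyclicDecomposition

variable {G : Type*} [AddCommGroup G] [Fintype G] (D : CyclicDecomposition G) {S : Set G}
  (hS : IsConnectionSet S) {k μ : ℕ} {ε : G → ℤ}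
  (h : (SimpleGraph.addCayley S).IsDesignGraph k μ ε)

open scoped Classical

include hS in
/-- The characters are eigenvectors of the adjacency matrix. -/
theorem adjMatrix_mulVec_char (g : G) :
    (addCayley S).adjMatrix ℂ *ᵥ D.char g = D.charSum g S • D.char g := by
  ext x
  simp only [Matrix.mulVec, dotProduct, adjMatrix_apply, addCayley_adj_iff hS, ite_mul, one_mul,
    zero_mul, Pi.smul_apply, smul_eq_mul, charSum, Finset.sum_mul, ← char_add_right]
  rw [← Finset.sum_filter]
  refine Finset.sum_nbij' (fun y => y - x) (fun y => y + x) ?_ ?_ ?_ ?_ ?_ <;> simp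

include hS h

theorem charSum_zero_eq : D.charSum 0 S = k := by
  rw [charSum_zero, ← h.ncard_nbrs 0]
  simp [addCayley_adj_iff hS]

theorem charSum_equations (g : G) :
    (D.charSum g S - k) * ∑ y, D.char g y = 0 ∧
    (D.charSum g S + k) * ∑ y, (ε y : ℂ) * D.char g y = 0 ∧
    ∀ x, (D.charSum g S ^ 2 - (k - μ)) * D.char g x =
      μ / 2 * (∑ y, D.char g y + ε x * ∑ y, (ε y : ℂ) * D.char g y) :=
  h.eigenvector_equations (by convert adjMatrix_mulVec_char D hS g)

theorem charSum_eq_k_iff (g : G) : D.charSum g S = k ↔ g = 0 := by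
  constructor
  · intro hg
    obtain ⟨-, h2, h3⟩ := h.charSum_equations D hS g
    have hk := h.cast_k_ne_zero ℂ
    have hμ : (μ : ℂ) ≠ 0 := by exact_mod_cast h.pos.ne'
    rw [hg, mul_eq_zero, ← two_mul] at h2
    have hb := h2.resolve_left (mul_ne_zero two_ne_zero hk)
    rw [hg, hb, h.card_eq ℂ] at h3
    apply D.eq_zero_of_char_eq_one
    intro x
    have h4 := (h3 x).trans (by ring : _ = μ / 2 * (∑ y, D.char g y + ε 0 * 0))
    rw [← h3 0, char_zero_right] at h4
    refine mul_left_cancel₀ ?_ h4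
    rw [add_sub_cancel_left]
    exact div_ne_zero (mul_ne_zero hμ (h.card_ne_zero ℂ)) two_ne_zero
  · rintro rfl
    exact h.charSum_zero_eq D hS

/-- A character with eigenvalue `-k` is, up to sign, the sign vector of the bipartition. -/
theorem char_of_charSum_eq_neg {g : G} (hg : D.charSum g S = -k) (x : G) :
    D.char g x = ε x * ε 0 := by
  obtain ⟨h2, -, h3⟩ := h.charSum_equations D hS g
  have hk := h.cast_k_ne_zero ℂ
  have hμ : (μ : ℂ) ≠ 0 := by exact_mod_cast h.pos.ne'
  rw [hg] at h2
  have hb := (mul_eq_zero.1 h2).resolve_left fun h0 => hk (by linear_combination -h0 / 2)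
  rw [hg, hb, neg_sq, h.card_eq ℂ] at h3
  have h4 := h3 x
  have h5 := h3 0
  have h6 : (ε 0 : ℂ) * ε 0 = 1 := by exact_mod_cast h.sign_sq 0
  rw [char_zero_right] at h5
  refine mul_left_cancel₀ (mul_ne_zero hμ (h.card_ne_zero ℂ)) ?_
  linear_combination 2 * h4 - 2 * ε x * ε 0 * h5 -
    μ * ε x * (∑ y, (ε y : ℂ) * D.char g y) * h6

theorem charSum_sq {g : G} (h0 : D.charSum g S ≠ k) (h1 : D.charSum g S ≠ -k) :
    D.charSum g S ^ 2 = k - μ := by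
  obtain ⟨ha, hb, h3⟩ := h.charSum_equations D hS g
  have ha := (mul_eq_zero.1 ha).resolve_left (sub_ne_zero.2 h0)
  have hb := (mul_eq_zero.1 hb).resolve_left fun h2 => h1 (by linear_combination h2)
  have h4 := h3 0
  rw [ha, hb, char_zero_right] at h4
  linear_combination h4

/-- The eigenvalue `-k` is afforded by some character, as the sum of the squares of the
eigenvalues shows. -/
theorem exists_charSum_eq_neg : ∃ g, D.charSum g S = -k := by
  by_contra! hne
  have h1 : ∑ g, D.charSum g S * D.charSum g S = Fintype.card G * k := by
    have := D.sum_charSum_mul_charSum_sub S 0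
    simpa only [zero_sub, D.charSum_neg hS, h.charSum_zero_eq D hS] using this
  have h2 : ∀ g, D.charSum g S * D.charSum g S =
      (k - μ) + if g = 0 then (k : ℂ) ^ 2 - (k - μ) else 0 := by
    intro g
    split_ifs with hg
    · rw [(h.charSum_eq_k_iff D hS g).2 hg]; ring
    · rw [← sq, h.charSum_sq D hS (fun h0 => hg ((h.charSum_eq_k_iff D hS g).1 h0)) (hne g),
        add_zero]
  simp only [h2, Finset.sum_add_distrib, Finset.sum_const, Finset.sum_ite_eq', Finset.mem_univ,
    if_true, Finset.card_univ, nsmul_eq_mul, h.card_eq ℂ] at h1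
  have hμ : (μ : ℂ) ≠ 0 := by exact_mod_cast h.pos.ne'
  exact mul_ne_zero hμ (h.card_ne_zero ℂ) (by linear_combination -2 * h1)

theorem charSum_add {g₀ : G} (hg₀ : D.charSum g₀ S = -k) (g : G) :
    D.charSum (g + g₀) S = -D.charSum g S := by
  unfold charSum
  rw [← Finset.sum_neg_distrib]
  refine Finset.sum_congr rfl fun s hs => ?_
  have h1 : (addCayley S).Adj 0 s := by
    rw [addCayley_adj_iff hS]; simpa using hs
  have h6 : (ε 0 : ℂ) * ε 0 = 1 := by exact_mod_cast h.sign_sq 0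
  rw [char_add_left, h.char_of_charSum_eq_neg D hS hg₀, h.sign_adj _ _ h1]
  push_cast
  linear_combination -D.char g s * h6

theorem charSum_eq_neg_iff {g₀ : G} (hg₀ : D.charSum g₀ S = -k) (g : G) :
    D.charSum g S = -k ↔ g = g₀ := by
  constructor
  · intro hg
    apply D.eq_of_char_eq
    intro x
    rw [h.char_of_charSum_eq_neg D hS hg, h.char_of_charSum_eq_neg D hS hg₀]
  · rintro rfl; exact hg₀

/-! ### The dual graph -/

section

variable {g₀ : G} (hg₀ : D.charSum g₀ S = -k) {τ : ℝ} (hτ : τ ^ 2 = k - μ)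
include hg₀ hτ

omit hτ in
theorem add_self_eq_zero : g₀ + g₀ = 0 := by
  rw [← h.charSum_eq_k_iff D hS, h.charSum_add D hS hg₀, hg₀, neg_neg]

omit [AddCommGroup G] [Fintype G] hS h hg₀ in
theorem ofReal_sq : (τ : ℂ) ^ 2 = k - μ := by
  exact_mod_cast congrArg Complex.ofReal hτ

omit hS hg₀ in
theorem k_ne_tau : (k : ℂ) ≠ τ ∧ -(k : ℂ) ≠ τ := by
  have hμ : (μ : ℂ) ≠ 0 := by exact_mod_cast h.pos.ne'
  have hc := h.card_eq ℂ
  have hτc := ofReal_sq hτ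
  have key : (k : ℂ) ^ 2 ≠ (τ : ℂ) ^ 2 := fun h0 =>
    mul_ne_zero hμ (h.card_ne_zero ℂ) (by linear_combination 2 * h0 + 2 * hτc - 2 * hc)
  exact ⟨fun h0 => key (by rw [h0]), fun h0 => key (by rw [← h0, neg_sq])⟩

omit hτ in
theorem ne_zero_of_charSum_eq_neg : g₀ ≠ 0 := by
  rintro rfl
  rw [h.charSum_zero_eq D hS] at hg₀
  exact h.cast_k_ne_zero ℂ (by linear_combination hg₀ / 2)

theorem charSum_eq_or_neg {g : G} (h0 : g ≠ 0) (h1 : g ≠ g₀) :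
    D.charSum g S = τ ∨ D.charSum g S = -τ := by
  rw [← sq_eq_sq_iff_eq_or_eq_neg, ofReal_sq hτ]
  exact h.charSum_sq D hS (fun h2 => h0 ((h.charSum_eq_k_iff D hS g).1 h2))
    (fun h2 => h1 ((h.charSum_eq_neg_iff D hS hg₀ g).1 h2))

/-- The indicator function of the eigenvalue class of `τ`, in terms of the character sums. -/
theorem indicator_eq (g : G) : (if D.charSum g S = τ then (1 : ℂ) else 0) =
    2⁻¹ * (1 + D.charSum g S / τ - (1 + k / τ) * (if g = 0 then 1 else 0) -
      (1 - k / τ) * (if g = g₀ then 1 else 0)) := by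
  have hτ0 : (τ : ℂ) ≠ 0 := h.theta_ne_zero (ofReal_sq hτ)
  obtain ⟨hk1, hk2⟩ := h.k_ne_tau hτ
  have hne := h.ne_zero_of_charSum_eq_neg D hS hg₀
  by_cases h0 : g = 0
  · subst h0
    rw [h.charSum_zero_eq D hS]
    simp [hk1, hne.symm]
  by_cases h1 : g = g₀
  · subst h1
    rw [hg₀]
    simp [hk2, hne]
    ring
  rcases h.charSum_eq_or_neg D hS hg₀ hτ h0 h1 with h2 | h2
  · rw [h2]; simp [h0, h1, hτ0]; norm_num
  · have h3 : -(τ : ℂ) ≠ τ := fun h4 => hτ0 (by linear_combination -h4 / 2)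
    rw [h2]; simp [h0, h1, hτ0, h3]

theorem ncard_eigenClass : ((D.eigenClass S τ).ncard : ℂ) = Fintype.card G / 2 - 1 := by
  have h1 : ((D.eigenClass S τ).ncard : ℂ) = ∑ g, if D.charSum g S = τ then (1 : ℂ) else 0 := by
    rw [eigenClass, Set.ncard_setOf_eq, Finset.sum_boole]
  rw [h1]
  simp only [h.indicator_eq D hS hg₀ hτ, ← Finset.mul_sum, Finset.sum_sub_distrib,
    Finset.sum_add_distrib, ← Finset.sum_div, D.sum_charSum hS, Finset.sum_ite_eq',
    Finset.mem_univ, if_true, Finset.sum_const, Finset.card_univ, nsmul_eq_mul]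
  ring

/-- The convolution square of the indicator function of the eigenvalue class of `τ`. -/
theorem sum_indicator_mul_indicator (x : G) :
    ∑ g, (if D.charSum g S = τ then (1 : ℂ) else 0) *
      (if D.charSum (x - g) S = τ then (1 : ℂ) else 0) =
    2⁻¹ * (Fintype.card G / 2 - 1 + (Fintype.card G / 2 - k) * D.charSum x S / τ ^ 2 -
      (1 + k / τ) * (if D.charSum x S = τ then (1 : ℂ) else 0) -
      (1 - k / τ) * (if D.charSum x S = -τ then (1 : ℂ) else 0)) := by
  have hτ0 : (τ : ℂ) ≠ 0 := h.theta_ne_zero (ofReal_sq hτ)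
  set b : G → ℂ := fun g => if D.charSum g S = τ then (1 : ℂ) else 0 with hb
  have hsum : ∑ g, b g = Fintype.card G / 2 - 1 := by
    rw [← h.ncard_eigenClass D hS hg₀ hτ, eigenClass, Set.ncard_setOf_eq, hb, Finset.sum_boole]
  have hsub : D.charSum (x - g₀) S = -D.charSum x S := by
    rw [← h.charSum_add D hS hg₀, ← add_zero (x - g₀), ← h.add_self_eq_zero D hS hg₀]
    congr 1
    abel
  have hx : ∀ g y : G, x - g = y ↔ g = x - y := by
    intro g y; constructor <;> rintro rfl <;> abel
  have hbf : ∑ g, b g * D.charSum (x - g) S = (Fintype.card G / 2 - k) * D.charSum x S / τ := by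
    have h1 : ∀ g, b g * D.charSum (x - g) S = 2⁻¹ * (D.charSum (x - g) S +
        (D.charSum g S * D.charSum (x - g) S) / τ -
        (1 + k / τ) * (if g = 0 then D.charSum (x - g) S else 0) -
        (1 - k / τ) * (if g = g₀ then D.charSum (x - g) S else 0)) := by
      intro g
      rw [hb]
      beta_reduce
      rw [h.indicator_eq D hS hg₀ hτ]
      split_ifs <;> ring
    have h2 : ∑ g, D.charSum (x - g) S = 0 := by
      rw [← D.sum_charSum hS]
      exact Equiv.sum_comp (Equiv.subLeft x) fun g => D.charSum g S
    simp only [h1, ← Finset.mul_sum, Finset.sum_sub_distrib, Finset.sum_add_distrib,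
      ← Finset.sum_div, D.sum_charSum_mul_charSum_sub, h2, Finset.sum_ite_eq', Finset.mem_univ,
      if_true, sub_zero, hsub]
    field_simp
    ring
  have h1 : ∀ g, b g * b (x - g) = 2⁻¹ * (b g + (b g * D.charSum (x - g) S) / τ -
      (1 + k / τ) * (if g = x then b g else 0) -
      (1 - k / τ) * (if g = x - g₀ then b g else 0)) := by
    intro g
    have h3 := h.indicator_eq D hS hg₀ hτ (x - g)
    simp only [hx, sub_zero] at h3
    change b (x - g) = _ at h3
    rw [h3]
    split_ifs <;> ring
  change ∑ g, b g * b (x - g) = _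
  simp only [h1, ← Finset.mul_sum, Finset.sum_sub_distrib, Finset.sum_add_distrib,
    ← Finset.sum_div, hsum, hbf, Finset.sum_ite_eq', Finset.mem_univ, if_true]
  have h4 : b (x - g₀) = if D.charSum x S = -τ then (1 : ℂ) else 0 := by
    simp only [hb, hsub, neg_eq_iff_eq_neg]
  rw [h4, show b x = if D.charSum x S = τ then (1 : ℂ) else 0 from rfl]
  field_simp

omit hg₀ in
theorem isConnectionSet_eigenClass : IsConnectionSet (D.eigenClass S τ) := by
  refine ⟨fun h0 => ?_, fun g hg => ?_⟩
  · rw [eigenClass, Set.mem_ofPred_eq, h.charSum_zero_eq D hS] at h0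
    exact (h.k_ne_tau hτ).1 h0
  · rw [eigenClass, Set.mem_ofPred_eq, D.charSum_neg hS]
    exact hg

/-- The number of common neighbours of two vertices in the dual graph is a value of the convolution
square of the indicator function. -/
theorem ncard_common_dual (x y : G) :
    ({z | (addCayley (D.eigenClass S τ)).Adj x z ∧
      (addCayley (D.eigenClass S τ)).Adj y z}.ncard : ℂ) =
    2⁻¹ * (Fintype.card G / 2 - 1 + (Fintype.card G / 2 - k) * D.charSum (y - x) S / τ ^ 2 -
      (1 + k / τ) * (if D.charSum (y - x) S = τ then (1 : ℂ) else 0) -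
      (1 - k / τ) * (if D.charSum (y - x) S = -τ then (1 : ℂ) else 0)) := by
  have hT := h.isConnectionSet_eigenClass D hS hτ
  rw [← h.sum_indicator_mul_indicator D hS hg₀ hτ, Set.ncard_setOf_eq, ← Finset.sum_boole]
  refine (Finset.sum_congr rfl fun z _ => ?_).trans (Equiv.sum_comp (Equiv.subRight x) _)
  have h1 : y - x - (z - x) = -(z - y) := by abel
  rw [Equiv.subRight_apply, h1, D.charSum_neg hS]
  have hadj : ∀ x, (addCayley (D.eigenClass S τ)).Adj x z ↔ D.charSum (z - x) S = τ :=
    fun x => addCayley_adj_iff hT x z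
  by_cases hx : D.charSum (z - x) S = τ <;> by_cases hy : D.charSum (z - y) S = τ <;>
    simp [hadj, hx, hy]

/-- The dual graph is a double cover of a complete graph, with fibres the cosets of `{0, g₀}`. -/
theorem exists_isDoubleCover_dual (hcard : 2 * k + 4 ≤ Fintype.card G) :
    ∃ k' a c, (addCayley (D.eigenClass S τ)).IsDoubleCover (· + g₀) k' a c := by
  have hτ0 : (τ : ℂ) ≠ 0 := h.theta_ne_zero (ofReal_sq hτ)
  have hττ : (τ : ℂ) ≠ -τ := fun h4 => hτ0 (by linear_combination h4 / 2)
  have hT := h.isConnectionSet_eigenClass D hS hτ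
  have hadj : ∀ x y, (addCayley (D.eigenClass S τ)).Adj x y ↔ D.charSum (y - x) S = τ :=
    fun x y => addCayley_adj_iff hT x y
  have hcount := h.ncard_common_dual D hS hg₀ hτ
  have hgg := h.add_self_eq_zero D hS hg₀
  have hne := h.ne_zero_of_charSum_eq_neg D hS hg₀
  have hpos : 0 < (D.eigenClass S τ).ncard := by
    refine Nat.pos_of_ne_zero fun h0 => ?_
    have h1 := h.ncard_eigenClass D hS hg₀ hτ
    rw [h0] at h1
    have h2 : (Fintype.card G : ℂ) = 2 := by push_cast at h1; linear_combination -2 * h1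
    have h3 : Fintype.card G = 2 := by exact_mod_cast h2
    omega
  obtain ⟨g, hg⟩ := Set.nonempty_of_ncard_ne_zero hpos.ne'
  change D.charSum g S = τ at hg
  have hg' : D.charSum (g + g₀) S = -τ := by rw [h.charSum_add D hS hg₀, hg]
  have hother : ∀ x y, y ≠ x → y ≠ x + g₀ → ¬ (addCayley (D.eigenClass S τ)).Adj x y →
      D.charSum (y - x) S = -τ := by
    intro x y h1 h2 h3
    rw [hadj] at h3
    refine (h.charSum_eq_or_neg D hS hg₀ hτ (sub_ne_zero.2 h1) ?_).resolve_left h3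
    rwa [ne_eq, sub_eq_iff_eq_add']
  obtain ⟨hp, hm⟩ := h.krein_pos hcard hτ
  refine ⟨(D.eigenClass S τ).ncard,
    {z | (addCayley (D.eigenClass S τ)).Adj 0 z ∧ (addCayley (D.eigenClass S τ)).Adj g z}.ncard,
    {z | (addCayley (D.eigenClass S τ)).Adj 0 z ∧
      (addCayley (D.eigenClass S τ)).Adj (g + g₀) z}.ncard,
    ⟨⟨0⟩, ?_, ?_, ?_, ?_, ?_, ?_, ?_, hpos, ?_, ?_⟩⟩
  · intro x
    simp only [add_assoc, hgg, add_zero]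
  · intro x
    simpa using hne
  · intro x
    rw [hadj, add_sub_cancel_left, hg₀]
    exact (h.k_ne_tau hτ).2
  · intro x y h1 h2
    rw [hadj, hadj, add_sub_right_comm, h.charSum_add D hS hg₀]
    rcases h.charSum_eq_or_neg D hS hg₀ hτ (g := y - x) (sub_ne_zero.2 h1)
      (by rwa [ne_eq, sub_eq_iff_eq_add']) with h3 | h3
    · simp [h3, hττ.symm]
    · simp [h3, hττ.symm]
  · intro x
    have h1 : {z | (addCayley (D.eigenClass S τ)).Adj x z} =
        (fun z => x + z) '' D.eigenClass S τ := by
      ext z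
      rw [Set.mem_ofPred_eq, addCayley_adj_iff hT, Set.mem_image]
      constructor
      · intro hz; exact ⟨z - x, hz, by abel⟩
      · rintro ⟨w, hw, rfl⟩; simpa using hw
    rw [h1, Set.ncard_image_of_injective _ (add_right_injective x)]
  · intro x y hxy
    rw [hadj] at hxy
    rw [← Nat.cast_inj (R := ℂ), hcount, hcount, hxy, sub_zero, hg]
  · intro x y h1 h2 h3
    rw [← Nat.cast_inj (R := ℂ), hcount, hcount, hother x y h1 h2 h3, sub_zero, hg']
  · refine Nat.pos_of_ne_zero fun h0 => ?_
    have h1 := hcount 0 g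
    rw [h0, sub_zero, hg, if_pos rfl, if_neg hττ] at h1
    have h2 : ((Fintype.card G / 2 - 2 + (Fintype.card G / 2 - 2 * k) / τ : ℝ) : ℂ) = 0 := by
      push_cast at h1 ⊢
      field_simp at h1 ⊢
      linear_combination -h1
    exact hp.ne' (Complex.ofReal_eq_zero.1 h2)
  · refine Nat.pos_of_ne_zero fun h0 => ?_
    have h1 := hcount 0 (g + g₀)
    rw [h0, sub_zero, hg', if_pos rfl, if_neg hττ.symm] at h1
    have h2 : ((Fintype.card G / 2 - 2 - (Fintype.card G / 2 - 2 * k) / τ : ℝ) : ℂ) = 0 := by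
      push_cast at h1 ⊢
      field_simp at h1 ⊢
      linear_combination -h1
    exact hm.ne' (Complex.ofReal_eq_zero.1 h2)

end
end SimpleGraph.IsDesignGraph

theorem mainTheorem4 {G : Type*} [AddCommGroup G] [Fintype G] (D : CyclicDecomposition G)
    (S : Set G) (hS : IsConnectionSet S)
    (hreg : (SimpleGraph.addCayley S).IsDistanceRegular)
    (hdiam : (SimpleGraph.addCayley S).diam = 3)
    (hbip : (SimpleGraph.addCayley S).IsBipartite)
    (hanti : ¬ (SimpleGraph.addCayley S).IsAntipodal) :
    (∃ σ : Fin 4 → ℝ, (SimpleGraph.addCayley S).IsQPolynomialOrdering σ) ∧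
    ∀ σ : Fin 4 → ℝ, (SimpleGraph.addCayley S).IsQPolynomialOrdering σ →
      IsConnectionSet (D.eigenClass S (σ 1)) ∧
      (D.dualGraph S σ).IsDistanceRegular ∧
      (D.dualGraph S σ).diam = 3 ∧
      (D.dualGraph S σ).IsAntipodal ∧
      ¬ (D.dualGraph S σ).IsBipartite := by
  obtain ⟨k, μ, ε, h⟩ := hreg.exists_isDesignGraph hdiam hbip
  have hcard := h.two_mul_add_four_le hanti
  refine ⟨⟨_, h.isQPolynomialOrdering hcard⟩, fun σ hσ => ?_⟩
  have hτ := h.sq_eq_of_isQPolynomialOrdering hcard hσ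
  obtain ⟨g₀, hg₀⟩ := h.exists_charSum_eq_neg D hS
  obtain ⟨k', a, c, hdual⟩ := h.exists_isDoubleCover_dual D hS hg₀ hτ hcard
  exact ⟨h.isConnectionSet_eigenClass D hS hτ, hdual.isDistanceRegular, hdual.diam_eq,
    hdual.isAntipodal, hdual.not_isBipartite⟩
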